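/- Let $f$ be an isolated singularity in three variables: $f$ is a nonzero holomorphic function in a neighbourhood of $0\in\mathbb{C}^3$ with $f(0)=0$, $\nabla f(0)=0$ and $\nabla f(z)\neq 0$ for all $z\neq 0$ sufficiently close to $0$. Let $\sum_\nu a_\nu z^\nu$ be the Taylor expansion of $f$ at $0$, and let $\Gamma_+(f)\subset\mathbb{R}^3$ be the convex hull of $\bigcup_{a_\nu\neq 0}(\nu+\mathbb{R}^3_{\ge 0})$. A face of $\Gamma_+(f)$ is a set $\{v\in\Gamma_+(f):\langle u,v\rangle=\inf_{w\in\Gamma_+(f)}\langle u,w\rangle\}$ with $u\in\mathbb{R}^3_{\ge 0}\setminus\{0\}$, and $\Gamma^k(f)$ denotes the set of compact $k$-dimensional faces of $\Gamma_+(f)$. A face $S\in\Gamma^2(f)$ is exceptional if, for some coordinate axis $OX_i$, one vertex of $S$ is at (Euclidean) distance $1$ from $OX_i$ and the other vertices of $S$ are the vertices of a $1$-dimensional face lying in a coordinate plane that contains $OX_i$; let $E_f\subset\Gamma^2(f)$ be the set of exceptional faces. Let $\mathcal{J}$ be the set of all segments $I_1^k=\overline{(0,1,1)(k,0,0)}$,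 $I_2^k=\overline{(1,0,1)(0,k,0)}$, $I_3^k=\overline{(1,1,0)(0,0,k)}$ with $k\in\{2,3,\ldots\}$. Then $$\bigl(\Gamma^2(f)=\emptyset\ \text{ or }\ \Gamma^2(f)=E_f\neq\emptyset\bigr)\iff \Gamma^1(f)\cap\mathcal{J}\neq\emptyset.$$ -/

import Mathlib

open Topology

/-- The gradient `∇f(z) = (∂f/∂z₁, …, ∂f/∂zₙ)(z)`. -/
noncomputable def grad {n : ℕ} (f : (Fin n → ℂ) → ℂ) (z : Fin n → ℂ) : Fin n → ℂ :=
  fun i => fderiv ℂ f z (Pi.single i 1)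

/-- `f` is (a representative of a germ of) an isolated singularity at the origin: holomorphic near
`0`, not identically zero near `0`, `f(0) = 0`, `∇f(0) = 0`, and `∇f(z) ≠ 0` for all `z ≠ 0`
sufficiently close to `0`. -/
structure IsIsolatedSingularity {n : ℕ} (f : (Fin n → ℂ) → ℂ) : Prop where
  analyticAt : AnalyticAt ℂ f 0
  germ_ne_zero : ¬ ∀ᶠ z in 𝓝 (0 : Fin n → ℂ), f z = 0
  map_zero : f 0 = 0
  grad_zero : grad f 0 = 0
  isolated : ∀ᶠ z in 𝓝[≠] (0 : Fin n → ℂ), grad f z ≠ 0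

/-- The Taylor coefficient `a_ν = (1 / ν!) ∂^{|ν|} f / ∂z^ν (0)` of `f` at the origin: the
`|ν|`-th derivative at `0` is evaluated on `ν₁` copies of `e₁`, then `ν₂` copies of `e₂`, etc. -/
noncomputable def taylorCoeff {n : ℕ} (f : (Fin n → ℂ) → ℂ) (ν : Fin n → ℕ) : ℂ :=
  (∏ i, ((ν i).factorial : ℂ))⁻¹ *
    iteratedFDeriv ℂ (∑ i, ν i) f 0 (fun k => Pi.single (finSigmaFinEquiv.symm k).1 1)

/-- The Newton diagram `Γ₊(f)`: the convex hull of the union of the sets `ν + ℝ₊ⁿ` over all `ν`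
with `a_ν ≠ 0`. -/
def newtonDiagram {n : ℕ} (f : (Fin n → ℂ) → ℂ) : Set (EuclideanSpace ℝ (Fin n)) :=
  convexHull ℝ {x | ∃ ν : Fin n → ℕ, taylorCoeff f ν ≠ 0 ∧ ∀ i, (ν i : ℝ) ≤ x i}

/-- `l(u, A) = inf {⟨u, v⟩ : v ∈ A}`. -/
noncomputable def supportValue {n : ℕ} (u : EuclideanSpace ℝ (Fin n))
    (A : Set (EuclideanSpace ℝ (Fin n))) : ℝ :=
  sInf ((fun v => inner ℝ u v) '' A)

/-- `Δ(u, A) = {v ∈ A : ⟨u, v⟩ = l(u, A)}`. -/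
def supportFace {n : ℕ} (u : EuclideanSpace ℝ (Fin n))
    (A : Set (EuclideanSpace ℝ (Fin n))) : Set (EuclideanSpace ℝ (Fin n)) :=
  {v ∈ A | inner ℝ u v = supportValue u A}

/-- The Newton boundary `Γ(f)`: the family of all compact faces `Δ(u, Γ₊(f))`,
`u ∈ ℝ₊ⁿ \ {0}`, of the Newton diagram. -/
def newtonBoundary {n : ℕ} (f : (Fin n → ℂ) → ℂ) : Set (Set (EuclideanSpace ℝ (Fin n))) :=
  {S | IsCompact S ∧ ∃ u : EuclideanSpace ℝ (Fin n),
    (∀ i, 0 ≤ u i) ∧ u ≠ 0 ∧ S = supportFace u (newtonDiagram f)}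

/-- `Γᵏ(f)`: the set of `k`-dimensional compact faces of the Newton diagram. -/
def compactFaces {n : ℕ} (f : (Fin n → ℂ) → ℂ) (k : ℕ) : Set (Set (EuclideanSpace ℝ (Fin n))) :=
  {S ∈ newtonBoundary f | Module.finrank ℝ (vectorSpan ℝ S) = k}

/-- The coordinate axis `OXᵢ`. -/
def coordAxis {n : ℕ} (i : Fin n) : Set (EuclideanSpace ℝ (Fin n)) :=
  {x | ∀ j, j ≠ i → x j = 0}

/-- The coordinate hyperplane `{xⱼ = 0}`; it includes the axis `OXᵢ` exactly when `j ≠ i`. -/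
def coordHyperplane {n : ℕ} (j : Fin n) : Set (EuclideanSpace ℝ (Fin n)) :=
  {x | x j = 0}

/-- For `n ≥ 2`: `S` is an exceptional face of `f` with respect to the axis `OXᵢ`, i.e. an
`(n-1)`-dimensional compact face one of whose vertices `W` is at (Euclidean) distance `1` from
`OXᵢ` and whose other vertices are the vertices of an `(n-2)`-dimensional face `T` lying in a
coordinate hyperplane that includes `OXᵢ`. -/
def IsExceptionalFace {n : ℕ} (f : (Fin n → ℂ) → ℂ) (i : Fin n)
    (S : Set (EuclideanSpace ℝ (Fin n))) : Prop :=
  S ∈ compactFaces f (n - 1) ∧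
    ∃ W ∈ Set.extremePoints ℝ S, Metric.infDist W (coordAxis i) = 1 ∧
      ∃ T ∈ compactFaces f (n - 2),
        Set.extremePoints ℝ T = Set.extremePoints ℝ S \ {W} ∧
          ∃ j, j ≠ i ∧ T ⊆ coordHyperplane j

/-- The set `E_f` of exceptional faces of `f`. -/
def exceptionalFaces {n : ℕ} (f : (Fin n → ℂ) → ℂ) : Set (Set (EuclideanSpace ℝ (Fin n))) :=
  {S | ∃ i, IsExceptionalFace f i S}

/-- The segment `I_j^k` in `ℝ³` joining the point whose `j`-th coordinate is `0` and whose other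
coordinates are `1` to the point `k e_j`; e.g. for the third axis, from `(1,1,0)` to `(0,0,k)`. -/
noncomputable def specialSegment (j : Fin 3) (k : ℕ) : Set (EuclideanSpace ℝ (Fin 3)) :=
  segment ℝ (WithLp.toLp 2 (fun i => if i = j then (0 : ℝ) else 1))
    (EuclideanSpace.single j (k : ℝ))

/-- The family `𝒥 = {I_j^k : j = 1, 2, 3, k = 2, 3, …}`. -/
def specialSegments : Set (Set (EuclideanSpace ℝ (Fin 3))) :=
  {I | ∃ (j : Fin 3) (k : ℕ), 2 ≤ k ∧ I = specialSegment j k}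

/-!
Among the weights `u ≥ 0` with `⟨u, ν⟩ ≥ 1` for all exponents `ν` of `f`, take an extreme point `u`
of the set of those with the least coordinate sum; `⟨u, ·⟩ = 1` supports the Newton polyhedron where
the diagonal enters it. If all coordinates of `u` are positive, then the exponents on this plane
span `ℝ³`, so they span a compact `2`-dimensional face. If that face is exceptional, or if some
`u i` vanishes, then tilting `u` slightly in a direction `e_i - e_j` keeps it minimal, and the only
exponents left on the tilted plane are `e_i + e_j` and some `k e_l`: a special edge.

Conversely, let `ω = e_i + e_j` and `κ = k e_l` be the ends of a special edge. On a compact face,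
every exponent other than `ω` has `i`-th or `j`-th coordinate `0`. If `ν` with `ν_i = 0` and `μ`
with `μ_j = 0` lie on the same face and `ν_j`, `μ_i` are nonzero, then `k μ_i ν + k ν_j μ` is a
combination of `ω` and `κ` with nonnegative coefficients. Comparing the weights of the face and of
the edge shows that `ν` lies on the edge, which is absurd, so all vertices but `ω` lie in one
coordinate plane.

An isolated singularity has an exponent in each coordinate plane: otherwise, on that plane, `∇f`
reduces to a single holomorphic function of two variables, whose zeros are not isolated. Likewise it
has exponents at distance at most `1` from each axis, as `∇f` does not vanish on the axis.
-/

theorem sum_fin_three_of_ne {M : Type*} [AddCommMonoid M] {i j l : Fin 3} (hij : i ≠ j)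
    (hil : i ≠ l) (hjl : j ≠ l) (g : Fin 3 → M) : ∑ m, g m = g i + g j + g l := by
  have huniv : (Finset.univ : Finset (Fin 3)) = {i, j, l} := by
    revert i j l; decide
  rw [huniv, Finset.sum_insert (by simp [hij, hil]), Finset.sum_insert (by simpa using hjl),
    Finset.sum_singleton, add_assoc]

theorem forall_fin_three_of_ne {i j l : Fin 3} (hij : i ≠ j) (hil : i ≠ l) (hjl : j ≠ l)
    {p : Fin 3 → Prop} : (∀ m, p m) ↔ p i ∧ p j ∧ p l := by
  refine ⟨fun h => ⟨h i, h j, h l⟩, fun ⟨hi, hj, hl⟩ m => ?_⟩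
  obtain rfl | rfl | rfl : m = i ∨ m = j ∨ m = l := by omega
  exacts [hi, hj, hl]

theorem exists_fin_three_ne_ne {i j : Fin 3} (hij : i ≠ j) : ∃ l, i ≠ l ∧ j ≠ l := by
  revert i j; decide

section LatticeWeight

variable {n : ℕ}

/-- The value at the lattice point `ν` of the linear form with coefficients `u`. -/
noncomputable def latticeWeight (u : Fin n → ℝ) (ν : Fin n → ℕ) : ℝ :=
  u ⬝ᵥ fun i => (ν i : ℝ)

theorem add_latticeWeight (u v : Fin n → ℝ) (ν : Fin n → ℕ) :
    latticeWeight (u + v) ν = latticeWeight u ν + latticeWeight v ν :=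
  add_dotProduct ..

theorem sub_latticeWeight (u v : Fin n → ℝ) (ν : Fin n → ℕ) :
    latticeWeight (u - v) ν = latticeWeight u ν - latticeWeight v ν :=
  sub_dotProduct ..

theorem neg_latticeWeight (u : Fin n → ℝ) (ν : Fin n → ℕ) :
    latticeWeight (-u) ν = -latticeWeight u ν :=
  neg_dotProduct ..

theorem smul_latticeWeight (ε : ℝ) (u : Fin n → ℝ) (ν : Fin n → ℕ) :
    latticeWeight (ε • u) ν = ε * latticeWeight u ν :=
  smul_dotProduct ..

theorem single_latticeWeight (i : Fin n) (ν : Fin n → ℕ) :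
    latticeWeight (Pi.single i 1) ν = ν i :=
  single_one_dotProduct ..

theorem latticeWeight_add (u : Fin n → ℝ) (ν μ : Fin n → ℕ) :
    latticeWeight u (ν + μ) = latticeWeight u ν + latticeWeight u μ := by
  simp only [latticeWeight, dotProduct, Pi.add_apply, Nat.cast_add, mul_add,
    Finset.sum_add_distrib]

theorem latticeWeight_nsmul (u : Fin n → ℝ) (p : ℕ) (ν : Fin n → ℕ) :
    latticeWeight u (p • ν) = p * latticeWeight u ν := by
  simp only [latticeWeight, dotProduct, Pi.smul_apply, smul_eq_mul, Nat.cast_mul, Finset.mul_sum,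
    mul_left_comm]

theorem latticeWeight_single (u : Fin n → ℝ) (i : Fin n) (k : ℕ) :
    latticeWeight u (Pi.single i k) = u i * k := by
  simp [latticeWeight, dotProduct, Pi.single_apply]

theorem latticeWeight_mono {u : Fin n → ℝ} (hu : ∀ i, 0 ≤ u i) : Monotone (latticeWeight u) :=
  fun _ _ h => dotProduct_le_dotProduct_of_nonneg_left (fun i => Nat.cast_le.2 (h i)) hu

theorem latticeWeight_strictMono {u : Fin n → ℝ} (hu : ∀ i, 0 < u i) :
    StrictMono (latticeWeight u) := by
  intro ν μ h
  obtain ⟨hle, i, hi⟩ := Pi.lt_def.1 h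
  exact Finset.sum_lt_sum
    (fun m _ => mul_le_mul_of_nonneg_left (Nat.cast_le.2 (hle m)) (hu m).le)
    ⟨i, Finset.mem_univ i, mul_lt_mul_of_pos_left (Nat.cast_lt.2 hi) (hu i)⟩

theorem latticeWeight_nonneg {u : Fin n → ℝ} (hu : ∀ i, 0 ≤ u i) (ν : Fin n → ℕ) :
    0 ≤ latticeWeight u ν :=
  dotProduct_nonneg_of_nonneg hu fun _ => Nat.cast_nonneg _

theorem latticeWeight_pos {u : Fin n → ℝ} (hu : ∀ i, 0 < u i) {ν : Fin n → ℕ} (hν : ν ≠ 0) :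
    0 < latticeWeight u ν :=
  (latticeWeight_nonneg (fun i => (hu i).le) 0).trans_lt
    (latticeWeight_strictMono hu (pos_iff_ne_zero.2 hν))

theorem latticeWeight_eq_of_ne {i j l : Fin 3} (hij : i ≠ j) (hil : i ≠ l) (hjl : j ≠ l)
    (u : Fin 3 → ℝ) (ν : Fin 3 → ℕ) :
    latticeWeight u ν = u i * ν i + u j * ν j + u l * ν l :=
  sum_fin_three_of_ne hij hil hjl fun m => u m * ν m

end LatticeWeight

section MinimalWeights

variable {n : ℕ} {F : Set (Fin n → ℕ)} {u v : Fin n → ℝ}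

/-- The points of `F` on the hyperplane `⟨u, ·⟩ = c`. -/
def activePoints (F : Set (Fin n → ℕ)) (u : Fin n → ℝ) (c : ℝ) : Set (Fin n → ℕ) :=
  {ν ∈ F | latticeWeight u ν = c}

/-- The weights that are nonnegative and at least `1` on `F`. -/
def feasibleWeights (F : Set (Fin n → ℕ)) : Set (Fin n → ℝ) :=
  {u | (∀ i, 0 ≤ u i) ∧ ∀ ν ∈ F, 1 ≤ latticeWeight u ν}

/-- The feasible weights with the least coordinate sum: the normalized supporting hyperplanes of
the Newton polyhedron of `F` at the point where the diagonal enters it. -/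
def minimalWeights (F : Set (Fin n → ℕ)) : Set (Fin n → ℝ) :=
  {u ∈ feasibleWeights F | ∀ w ∈ feasibleWeights F, ∑ i, u i ≤ ∑ i, w i}

theorem isClosed_feasibleWeights (F : Set (Fin n → ℕ)) : IsClosed (feasibleWeights F) := by
  simp only [feasibleWeights, latticeWeight, Set.ofPred_and, Set.ofPred_forall]
  exact (isClosed_iInter fun i => isClosed_le continuous_const (continuous_apply i)).inter
    (isClosed_biInter fun ν _ => isClosed_le continuous_const (by unfold dotProduct; fun_prop))

theorem isCompact_feasibleWeights_inter (F : Set (Fin n → ℕ)) (C : ℝ) :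
    IsCompact (feasibleWeights F ∩ {u | ∑ i, u i ≤ C}) := by
  refine (isCompact_Icc (a := (0 : Fin n → ℝ)) (b := fun _ => C)).of_isClosed_subset
    ((isClosed_feasibleWeights F).inter (isClosed_le (by fun_prop) continuous_const)) ?_
  rintro u ⟨hu, hC⟩
  exact ⟨fun i => hu.1 i, fun i =>
    (Finset.single_le_sum (f := u) (fun i _ => hu.1 i) (Finset.mem_univ i)).trans hC⟩

theorem one_mem_feasibleWeights (h0 : 0 ∉ F) : 1 ∈ feasibleWeights F := by
  refine ⟨fun _ => zero_le_one, fun ν hν => ?_⟩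
  obtain ⟨i, hi⟩ : ∃ i, ν i ≠ 0 := Function.ne_iff.1 (ne_of_mem_of_not_mem hν h0)
  calc (1 : ℝ) ≤ ν i := by exact_mod_cast Nat.one_le_iff_ne_zero.2 hi
    _ ≤ ∑ i, (ν i : ℝ) := Finset.single_le_sum (f := fun i => (ν i : ℝ))
      (fun _ _ => Nat.cast_nonneg _) (Finset.mem_univ i)
    _ = latticeWeight 1 ν := (one_dotProduct _).symm

theorem minimalWeights_nonempty (h0 : 0 ∉ F) : (minimalWeights F).Nonempty := by
  obtain ⟨u, hu, hmin⟩ := (isCompact_feasibleWeights_inter F (∑ _ : Fin n, 1)).exists_isMinOn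
    ⟨1, one_mem_feasibleWeights h0, (le_refl (∑ _ : Fin n, (1 : ℝ)) :)⟩
    (f := fun u => ∑ i, u i) (by fun_prop)
  refine ⟨u, hu.1, fun w hw => ?_⟩
  rcases le_total (∑ i, w i) (∑ _ : Fin n, 1) with h | h
  · exact hmin ⟨hw, h⟩
  · exact hu.2.trans h

theorem isCompact_minimalWeights (F : Set (Fin n → ℕ)) : IsCompact (minimalWeights F) := by
  rcases (minimalWeights F).eq_empty_or_nonempty with h | ⟨u, hu⟩
  · rw [h]; exact isCompact_empty
  · convert isCompact_feasibleWeights_inter F (∑ i, u i) using 1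
    ext w
    exact ⟨fun hw => ⟨hw.1, hw.2 u hu.1⟩, fun hw => ⟨hw.1, fun x hx => hw.2.trans (hu.2 x hx)⟩⟩

theorem eventually_le_add_mul {a b c : ℝ} (ha : c ≤ a) (hb : a = c → 0 ≤ b) :
    ∀ᶠ ε in 𝓝[>] (0 : ℝ), c ≤ a + ε * b ∧ (a + ε * b = c → a = c ∧ b = 0) := by
  rcases ha.eq_or_lt with rfl | hlt
  · filter_upwards [self_mem_nhdsWithin] with ε (hε : 0 < ε)
    refine ⟨le_add_of_nonneg_right (mul_nonneg hε.le (hb rfl)), fun h => ⟨rfl, ?_⟩⟩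
    exact (mul_eq_zero.1 (add_eq_left.1 h)).resolve_left hε.ne'
  · have hcont : ContinuousAt (fun ε : ℝ => a + ε * b) 0 := by fun_prop
    filter_upwards [nhdsWithin_le_nhds (hcont.eventually (lt_mem_nhds (by simpa using hlt)))]
      with ε hε
    exact ⟨hε.le, fun h => absurd h hε.ne'⟩

theorem eventually_add_smul_mem_feasibleWeights (hF : F.Finite) (hu : u ∈ feasibleWeights F)
    (hv : ∀ ν ∈ activePoints F u 1, 0 ≤ latticeWeight v ν) (hv0 : ∀ i, u i = 0 → 0 ≤ v i) :
    ∀ᶠ ε in 𝓝[>] (0 : ℝ), u + ε • v ∈ feasibleWeights F ∧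
      (∀ ν ∈ activePoints F (u + ε • v) 1, ν ∈ activePoints F u 1 ∧ latticeWeight v ν = 0) ∧
      ∀ i, (u + ε • v) i = 0 → u i = 0 ∧ v i = 0 := by
  have hpoints := (Filter.eventually_all_finite hF).2 fun ν hν =>
    eventually_le_add_mul (hu.2 ν hν) fun h => hv ν ⟨hν, h⟩
  have hcoords := Filter.eventually_all.2 fun i => eventually_le_add_mul (hu.1 i) (hv0 i)
  filter_upwards [hpoints, hcoords] with ε hpoints hcoords
  simp only [← smul_latticeWeight, ← add_latticeWeight] at hpoints
  exact ⟨⟨fun i => (hcoords i).1, fun ν hν => (hpoints ν hν).1⟩,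
    fun ν ⟨hν, h⟩ => ⟨⟨hν, ((hpoints ν hν).2 h).1⟩, ((hpoints ν hν).2 h).2⟩,
    fun i => (hcoords i).2⟩

theorem sum_add_smul (u v : Fin n → ℝ) (ε : ℝ) :
    ∑ i, (u + ε • v) i = ∑ i, u i + ε * ∑ i, v i := by
  simp only [Pi.add_apply, Pi.smul_apply, smul_eq_mul, Finset.sum_add_distrib, Finset.mul_sum]

theorem sum_nonneg_of_mem_minimalWeights (hF : F.Finite) (hu : u ∈ minimalWeights F)
    (hv : ∀ ν ∈ activePoints F u 1, 0 ≤ latticeWeight v ν) (hv0 : ∀ i, u i = 0 → 0 ≤ v i) :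
    0 ≤ ∑ i, v i := by
  obtain ⟨ε, ⟨hfeas, -⟩, hε⟩ :=
    ((eventually_add_smul_mem_feasibleWeights hF hu.1 hv hv0).and self_mem_nhdsWithin).exists
  have hle := hu.2 _ hfeas
  rw [sum_add_smul, le_add_iff_nonneg_right] at hle
  exact nonneg_of_mul_nonneg_right hle hε

theorem add_smul_mem_minimalWeights {ε : ℝ} (hu : u ∈ minimalWeights F)
    (h : u + ε • v ∈ feasibleWeights F) (hv : ∑ i, v i = 0) : u + ε • v ∈ minimalWeights F :=
  ⟨h, fun w hw => by simpa only [sum_add_smul, hv, mul_zero, add_zero] using hu.2 w hw⟩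

theorem exists_mem_activePoints_ne_zero (hF : F.Finite) (hu : u ∈ minimalWeights F) {i : Fin n}
    (hi : 0 < u i) : ∃ ν ∈ activePoints F u 1, ν i ≠ 0 := by
  by_contra! h
  have hsum := sum_nonneg_of_mem_minimalWeights hF hu (v := -Pi.single i 1)
    (fun ν hν => by simp [neg_latticeWeight, single_latticeWeight, h ν hν])
    fun m hm => by simp [show m ≠ i by rintro rfl; exact hi.ne' hm]
  norm_num at hsum

theorem eq_zero_of_latticeWeight_eq_zero_on_activePoints (hF : F.Finite)
    (hu : u ∈ (minimalWeights F).extremePoints ℝ) (hpos : ∀ i, 0 < u i)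
    (hv : ∀ ν ∈ activePoints F u 1, latticeWeight v ν = 0) : v = 0 := by
  have hneg : ∀ ν ∈ activePoints F u 1, latticeWeight (-v) ν = 0 := fun ν hν => by
    rw [neg_latticeWeight, hv ν hν, neg_zero]
  have hzero : ∀ w : Fin n → ℝ, ∀ i, u i = 0 → 0 ≤ w i := fun _ i h => absurd h (hpos i).ne'
  have hsum : ∑ i, v i = 0 := by
    have h₁ := sum_nonneg_of_mem_minimalWeights hF hu.1 (fun ν hν => (hv ν hν).ge) (hzero v)
    have h₂ := sum_nonneg_of_mem_minimalWeights hF hu.1 (fun ν hν => (hneg ν hν).ge) (hzero (-v))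
    simp only [Pi.neg_apply, Finset.sum_neg_distrib] at h₂
    linarith
  obtain ⟨ε, ⟨⟨hplus, -⟩, hminus, -⟩, hε : 0 < ε⟩ :=
    (((eventually_add_smul_mem_feasibleWeights hF hu.1.1 (fun ν hν => (hv ν hν).ge)
      (hzero v)).and (eventually_add_smul_mem_feasibleWeights hF hu.1.1
      (fun ν hν => (hneg ν hν).ge) (hzero (-v)))).and self_mem_nhdsWithin).exists
  have heq := hu.2 (add_smul_mem_minimalWeights hu.1 hplus hsum)
    (add_smul_mem_minimalWeights hu.1 hminus (by simp [hsum]))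
    ⟨1 / 2, 1 / 2, by norm_num, by norm_num, by norm_num, by module⟩
  simpa [hε.ne'] using heq

end MinimalWeights

/-! ### Special edges and exceptional faces in terms of lattice points -/

/-- A weight with positive coordinates that is at least `c` on `F`, so that the active points at
level `c`, if any, span a compact face of the Newton polyhedron of `F`. -/
structure IsSupportingWeight {n : ℕ} (F : Set (Fin n → ℕ)) (u : Fin n → ℝ) (c : ℝ) : Prop where
  pos : ∀ i, 0 < u i
  le : ∀ ν ∈ F, c ≤ latticeWeight u ν

/-- The lattice end point of the segments `specialSegment l k` that does not depend on `k`. -/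
def specialVertex (l : Fin 3) : Fin 3 → ℕ := fun i => if i = l then 0 else 1

/-- The Newton polyhedron of `F` has a segment `I_l^k`, `k ≥ 2`, as a compact edge, and the edge
contains no points of `F` but its ends. -/
def HasSpecialEdge (F : Set (Fin 3 → ℕ)) : Prop :=
  ∃ l k, 2 ≤ k ∧ ∃ u c, IsSupportingWeight F u c ∧
    activePoints F u c = {specialVertex l, Pi.single l k}

/-- The lattice version of an exceptional face: some point of `G` is at distance `1` from the
`i`-th axis, inside the coordinate plane of the `i`-th and `j`-th axes, and all the others lie in
the hyperplane where the `j`-th coordinate vanishes. -/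
def HasExceptionalApex {n : ℕ} (G : Set (Fin n → ℕ)) : Prop :=
  ∃ i j, i ≠ j ∧ ∃ ω ∈ G, ω j = 1 ∧ (∀ l, l ≠ i → l ≠ j → ω l = 0) ∧
    ∀ ν ∈ G, ν ≠ ω → ν j = 0

/-- The combinatorial conditions met by the exponents of an isolated singularity in three variables.
In `near_axis`, the bound by `m e_i + e_j` encodes that `ν` is at distance at most `1` from the
`i`-th axis. -/
structure IsAdmissibleSupport {n : ℕ} (A : Set (Fin n → ℕ)) : Prop where
  two_le_sum : ∀ ν ∈ A, 2 ≤ ∑ i, ν i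
  near_axis : ∀ i, ∃ ν ∈ A, ∃ j m, ν ≤ Pi.single i m + Pi.single j 1
  meets_hyperplane : ∀ j, ∃ ν ∈ A, ν j = 0

theorem IsAdmissibleSupport.of_forall_exists_le {n : ℕ} {A F : Set (Fin n → ℕ)}
    (hA : IsAdmissibleSupport A) (hFA : F ⊆ A) (hdom : ∀ ν ∈ A, ∃ μ ∈ F, μ ≤ ν) :
    IsAdmissibleSupport F where
  two_le_sum ν hν := hA.two_le_sum ν (hFA hν)
  near_axis i := by
    obtain ⟨ν, hν, j, m, hle⟩ := hA.near_axis i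
    obtain ⟨μ, hμ, hμν⟩ := hdom ν hν
    exact ⟨μ, hμ, j, m, hμν.trans hle⟩
  meets_hyperplane j := by
    obtain ⟨ν, hν, hj⟩ := hA.meets_hyperplane j
    obtain ⟨μ, hμ, hμν⟩ := hdom ν hν
    exact ⟨μ, hμ, Nat.le_zero.1 (hj ▸ hμν j)⟩

section FinThree

variable {F : Set (Fin 3 → ℕ)} {u : Fin 3 → ℝ} {i j l : Fin 3}

theorem eq_specialVertex_iff (hij : i ≠ j) (hil : i ≠ l) (hjl : j ≠ l) {ν : Fin 3 → ℕ} :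
    ν = specialVertex l ↔ ν i = 1 ∧ ν j = 1 ∧ ν l = 0 := by
  rw [funext_iff, forall_fin_three_of_ne hij hil hjl]
  simp [specialVertex, hil, hjl]

theorem eq_single_iff (hij : i ≠ j) (hil : i ≠ l) (hjl : j ≠ l) {ν : Fin 3 → ℕ} {k : ℕ} :
    ν = Pi.single l k ↔ ν i = 0 ∧ ν j = 0 ∧ ν l = k := by
  rw [funext_iff, forall_fin_three_of_ne hij hil hjl]
  simp [hil, hjl]

theorem hasSpecialEdge_of_subset (hF : F.Finite) (hdeg : ∀ ν ∈ F, 2 ≤ ∑ i, ν i)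
    (hu : u ∈ minimalWeights F) (hpos : ∀ i, 0 < u i)
    (hact : activePoints F u 1 ⊆ insert (specialVertex l) (Set.range (Pi.single l))) :
    HasSpecialEdge F := by
  obtain ⟨j, hjl⟩ := exists_ne l
  obtain ⟨ω, hω, hωj⟩ := exists_mem_activePoints_ne_zero hF hu (hpos j)
  obtain rfl : ω = specialVertex l := (hact hω).resolve_right fun ⟨k, hk⟩ => hωj (by
    rw [← hk, Pi.single_eq_of_ne hjl])
  obtain ⟨κ, hκ, hκl⟩ := exists_mem_activePoints_ne_zero hF hu (hpos l)
  obtain ⟨k, rfl⟩ : κ ∈ Set.range (Pi.single l) := (hact hκ).resolve_left fun h => hκl (by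
    simp [h, specialVertex])
  refine ⟨l, k, by simpa using hdeg _ hκ.1, u, 1, ⟨hpos, hu.1.2⟩,
    Set.Subset.antisymm (fun ν hν => (hact hν).imp id ?_) (Set.pair_subset hω hκ)⟩
  rintro ⟨m, rfl⟩
  have hmk := hν.2.trans hκ.2.symm
  rw [latticeWeight_single, latticeWeight_single] at hmk
  rw [Nat.cast_injective (mul_left_cancel₀ (hpos l).ne' hmk)]
  rfl

theorem hasSpecialEdge_of_mem_minimalWeights (hF : F.Finite) (hdeg : ∀ ν ∈ F, 2 ≤ ∑ i, ν i)
    (hu : u ∈ minimalWeights F) (hij : i ≠ j) (hil : i ≠ l) (hjl : j ≠ l) (hj : 0 < u j)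
    (hl : 0 < u l) (hact : ∀ ν ∈ activePoints F u 1, ν j = 0 ∨ ν j = 1 ∧ ν l = 0) :
    HasSpecialEdge F := by
  set v : Fin 3 → ℝ := Pi.single i 1 - Pi.single j 1 with hv
  have hvν (ν : Fin 3 → ℕ) : latticeWeight v ν = ν i - ν j := by
    rw [hv, sub_latticeWeight, single_latticeWeight, single_latticeWeight]
  have hvact : ∀ ν ∈ activePoints F u 1, 0 ≤ latticeWeight v ν := by
    intro ν hν
    have hle : ν j ≤ ν i := by
      have hsum := hdeg ν hν.1
      rw [sum_fin_three_of_ne hij hil hjl] at hsum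
      have hcases := hact ν hν
      omega
    rw [hvν, sub_nonneg]
    exact_mod_cast hle
  have hv0 : ∀ m, u m = 0 → 0 ≤ v m := by
    rw [forall_fin_three_of_ne hij hil hjl]
    simp [hv, hij, hil.symm, hjl.symm, hj.ne']
  obtain ⟨ε, hfeas, htilt, hzero⟩ :=
    (eventually_add_smul_mem_feasibleWeights hF hu.1 hvact hv0).exists
  have hmin := add_smul_mem_minimalWeights hu hfeas (by simp [hv])
  have hne : ∀ m, (u + ε • v) m ≠ 0 := by
    refine (forall_fin_three_of_ne hij hil hjl).2
      ⟨fun h => ?_, fun h => hj.ne' (hzero j h).1, fun h => hl.ne' (hzero l h).1⟩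
    simpa [hv, hij] using (hzero i h).2
  refine hasSpecialEdge_of_subset (l := l) hF hdeg hmin
    (fun m => (hfeas.1 m).lt_of_ne (hne m).symm) fun ν hν => ?_
  obtain ⟨hνu, hνv⟩ := htilt ν hν
  have hνij : ν i = ν j := by
    rw [hvν, sub_eq_zero] at hνv
    exact_mod_cast hνv
  rcases hact ν hνu with h0 | ⟨h1, h0⟩
  · exact Or.inr ⟨ν l, ((eq_single_iff hij hil hjl).2 ⟨hνij.trans h0, h0, rfl⟩).symm⟩
  · exact Or.inl ((eq_specialVertex_iff hij hil hjl).2 ⟨hνij.trans h1, h1, h0⟩)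

theorem hasSpecialEdge_of_eq_zero (hF : F.Finite) (hA : IsAdmissibleSupport F)
    (hu : u ∈ minimalWeights F) (hi : u i = 0) : HasSpecialEdge F := by
  obtain ⟨ν, hν, j, m, hle⟩ := hA.near_axis i
  have hj : 1 ≤ u j := calc
    1 ≤ latticeWeight u ν := hu.1.2 ν hν
    _ ≤ latticeWeight u (Pi.single i m + Pi.single j 1) := latticeWeight_mono hu.1.1 hle
    _ = u j := by simp [latticeWeight_add, latticeWeight_single, hi]
  have hij : i ≠ j := by rintro rfl; linarith
  obtain ⟨l, hil, hjl⟩ := exists_fin_three_ne_ne hij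
  have hweight (μ : Fin 3 → ℕ) : latticeWeight u μ = u j * μ j + u l * μ l := by
    rw [latticeWeight_eq_of_ne hij hil hjl, hi, zero_mul, zero_add]
  have hl : 0 < u l := by
    obtain ⟨μ, hμ, hμj⟩ := hA.meets_hyperplane j
    have hge := hu.1.2 μ hμ
    rw [hweight, hμj, Nat.cast_zero, mul_zero, zero_add] at hge
    exact pos_of_mul_pos_left (by linarith) (Nat.cast_nonneg _)
  refine hasSpecialEdge_of_mem_minimalWeights hF hA.two_le_sum hu hij hil hjl
    (by linarith) hl fun μ hμ => or_iff_not_imp_left.2 fun hμj => ?_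
  have hactive : u j * μ j + u l * μ l = 1 := (hweight μ).symm.trans hμ.2
  have hμj1 : (1 : ℝ) ≤ μ j := by exact_mod_cast Nat.one_le_iff_ne_zero.2 hμj
  have hμl : 0 ≤ u l * μ l := by positivity
  constructor
  · refine le_antisymm ?_ (Nat.one_le_iff_ne_zero.2 hμj)
    exact_mod_cast (by nlinarith : (μ j : ℝ) ≤ 1)
  · have hzero : u l * μ l = 0 := by nlinarith
    exact_mod_cast (mul_eq_zero.1 hzero).resolve_left hl.ne'

theorem hasSpecialEdge_of_hasExceptionalApex (hF : F.Finite) (hA : IsAdmissibleSupport F)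
    (hE : ∀ u ∈ feasibleWeights F, (∀ i, 0 < u i) →
      (∀ v : Fin 3 → ℝ, (∀ ν ∈ activePoints F u 1, latticeWeight v ν = 0) → v = 0) →
      HasExceptionalApex (activePoints F u 1)) :
    HasSpecialEdge F := by
  have h0 : (0 : Fin 3 → ℕ) ∉ F := fun h => by simpa using hA.two_le_sum 0 h
  obtain ⟨u, hu⟩ := (isCompact_minimalWeights F).extremePoints_nonempty (minimalWeights_nonempty h0)
  by_cases hz : ∃ i, u i = 0
  · obtain ⟨i, hi⟩ := hz
    exact hasSpecialEdge_of_eq_zero hF hA hu.1 hi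
  have hpos : ∀ i, 0 < u i := fun i => (hu.1.1.1 i).lt_of_ne fun h => hz ⟨i, h.symm⟩
  obtain ⟨i, j, hij, ω, -, hωj, hωl, hν⟩ := hE u hu.1.1 hpos fun v hv =>
    eq_zero_of_latticeWeight_eq_zero_on_activePoints hF hu hpos hv
  obtain ⟨l, hil, hjl⟩ := exists_fin_three_ne_ne hij
  refine hasSpecialEdge_of_mem_minimalWeights hF hA.two_le_sum hu.1 hij hil hjl (hpos j) (hpos l)
    fun ν hν' => ?_
  rcases eq_or_ne ν ω with rfl | hne
  · exact Or.inr ⟨hωj, hωl l hil.symm hjl.symm⟩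
  · exact Or.inl (hν ν hν' hne)

end FinThree

-- Comparing `⟨w, ·⟩` on the two sides gives `r + s ≤ p + q`, comparing `⟨u, ·⟩` the converse,
-- strictly unless `ν` and `μ` are active for `u`.
theorem mem_activePoints_of_nsmul_add_nsmul_eq {n : ℕ} {F : Set (Fin n → ℕ)} {u w : Fin n → ℝ}
    {c d : ℝ} {ν μ ω κ : Fin n → ℕ} {p q r s : ℕ} (hu : IsSupportingWeight F u c)
    (hw : IsSupportingWeight F w d) (hω : ω ∈ activePoints F u c) (hκ : κ ∈ activePoints F u c)
    (hν : ν ∈ activePoints F w d) (hμ : μ ∈ activePoints F w d) (hν0 : ν ≠ 0) (hp : p ≠ 0)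
    (h : p • ν + q • μ = r • ω + s • κ) : ν ∈ activePoints F u c := by
  have hc : 0 ≤ c := hω.2 ▸ latticeWeight_nonneg (fun i => (hu.pos i).le) ω
  have hd : 0 < d := hν.2 ▸ latticeWeight_pos hw.pos hν0
  have huw (x : Fin n → ℝ) : p * latticeWeight x ν + q * latticeWeight x μ =
      r * latticeWeight x ω + s * latticeWeight x κ := by
    simpa only [latticeWeight_add, latticeWeight_nsmul] using congrArg (latticeWeight x) h
  have hcount : (r : ℝ) + s ≤ p + q := by
    refine le_of_mul_le_mul_right ?_ hd
    have hwr := huw w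
    rw [hν.2, hμ.2] at hwr
    nlinarith [mul_le_mul_of_nonneg_left (hw.le ω hω.1) r.cast_nonneg,
      mul_le_mul_of_nonneg_left (hw.le κ hκ.1) s.cast_nonneg]
  have hur := huw u
  rw [hω.2, hκ.2] at hur
  have hp' : (0 : ℝ) < p := by positivity
  refine ⟨hν.1, le_antisymm (le_of_mul_le_mul_left ?_ hp') (hu.le ν hν.1)⟩
  nlinarith [mul_le_mul_of_nonneg_right hcount hc,
    mul_le_mul_of_nonneg_left (hu.le μ hμ.1) q.cast_nonneg]

theorem IsSupportingWeight.eq_of_le {n : ℕ} {F : Set (Fin n → ℕ)} {w : Fin n → ℝ} {d : ℝ}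
    (hw : IsSupportingWeight F w d) {ω ν : Fin n → ℕ} (hω : ω ∈ F) (hν : ν ∈ activePoints F w d)
    (h : ω ≤ ν) : ν = ω := by
  by_contra hne
  exact ((latticeWeight_strictMono hw.pos (h.lt_of_ne' hne)).trans_eq hν.2).not_ge (hw.le ω hω)

theorem forall_mem_activePoints_of_hasSpecialEdge {F : Set (Fin 3 → ℕ)} {u w : Fin 3 → ℝ}
    {c d : ℝ} {i j l : Fin 3} {k : ℕ} (hij : i ≠ j) (hil : i ≠ l) (hjl : j ≠ l) (hk : k ≠ 0)
    (hu : IsSupportingWeight F u c)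
    (hact : activePoints F u c = {specialVertex l, Pi.single l k})
    (hw : IsSupportingWeight F w d) :
    (∀ ν ∈ activePoints F w d, ν ≠ specialVertex l → ν i = 0) ∨
      ∀ ν ∈ activePoints F w d, ν ≠ specialVertex l → ν j = 0 := by
  have hω : specialVertex l ∈ activePoints F u c := by simp [hact]
  have hκ : Pi.single l k ∈ activePoints F u c := by simp [hact]
  obtain ⟨hωi, hωj, hωl⟩ := (eq_specialVertex_iff hij hil hjl).1 (Eq.refl (specialVertex l))
  have hplane : ∀ ν ∈ activePoints F w d, ν ≠ specialVertex l → ν i = 0 ∨ ν j = 0 := by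
    intro ν hν hne
    by_contra! h
    refine hne (hw.eq_of_le hω.1 hν ?_)
    rw [Pi.le_def, forall_fin_three_of_ne hij hil hjl]
    omega
  by_contra! hcon
  obtain ⟨⟨μ, hμ, hμω, hμi⟩, ν, hν, hνω, hνj⟩ := hcon
  have hνi := (hplane ν hν hνω).resolve_right hνj
  have hμj := (hplane μ hμ hμω).resolve_left hμi
  have hrel : (k * μ i) • ν + (k * ν j) • μ = (k * μ i * ν j) • specialVertex l +
      (μ i * ν l + ν j * μ l) • Pi.single l k := by
    refine funext ((forall_fin_three_of_ne hij hil hjl).2 ?_)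
    simp only [Pi.add_apply, Pi.smul_apply, smul_eq_mul, Pi.single_eq_of_ne hil,
      Pi.single_eq_of_ne hjl, Pi.single_eq_same, hωi, hωj, hωl, hνi, hμj]
    exact ⟨by ring, by ring, by ring⟩
  have hνu := mem_activePoints_of_nsmul_add_nsmul_eq hu hw hω hκ hν hμ
    (fun h => hνj (by simp [h])) (mul_ne_zero hk hμi) hrel
  rw [hact] at hνu
  rcases hνu with rfl | rfl
  · exact hνω rfl
  · exact hνj (by simp [hjl])

theorem HasSpecialEdge.hasExceptionalApex {F : Set (Fin 3 → ℕ)} (h : HasSpecialEdge F)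
    {w : Fin 3 → ℝ} {d : ℝ} (hw : IsSupportingWeight F w d)
    (hdim : ∀ j, ∃ ν ∈ activePoints F w d, ν j ≠ 0) : HasExceptionalApex (activePoints F w d) := by
  obtain ⟨l, k, hk, u, c, hu, hact⟩ := h
  have hapex {i j : Fin 3} (hij : i ≠ j) (hil : i ≠ l) (hjl : j ≠ l)
      (hj : ∀ ν ∈ activePoints F w d, ν ≠ specialVertex l → ν j = 0) :
      HasExceptionalApex (activePoints F w d) := by
    obtain ⟨-, hωj, hωl⟩ := (eq_specialVertex_iff hij hil hjl).1 (Eq.refl (specialVertex l))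
    refine ⟨i, j, hij, specialVertex l, ?_, hωj, fun m hmi hmj => ?_, hj⟩
    · obtain ⟨ν, hν, hνj⟩ := hdim j
      exact of_not_not (fun h => hνj (hj ν hν h)) ▸ hν
    · rwa [show m = l by omega]
  obtain ⟨j, hjl⟩ := exists_ne l
  obtain ⟨i, hji, hli⟩ := exists_fin_three_ne_ne hjl
  rcases forall_mem_activePoints_of_hasSpecialEdge hji.symm hli.symm hjl (by omega) hu hact hw
    with hi | hj
  · exact hapex hji hjl hli.symm hi
  · exact hapex hji.symm hli.symm hjl hj

/-! ### Levels of linear forms on convex hulls -/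

section ConvexLevel

variable {E : Type*} [AddCommGroup E] [Module ℝ E]

theorem isExtreme_level (L : E →ₗ[ℝ] ℝ) {S : Set E} {c : ℝ} (h : ∀ x ∈ S, c ≤ L x) :
    IsExtreme ℝ S {x ∈ S | L x = c} := by
  refine ⟨Set.sep_subset .., fun x hx y hy z ⟨_, hz⟩ ⟨a, b, ha, hb, hab, hxyz⟩ => ⟨hx, ?_⟩⟩
  have hcomb : a * (L x - c) + b * (L y - c) = 0 := by
    rw [← hxyz, map_add, map_smul, map_smul, smul_eq_mul, smul_eq_mul] at hz
    linear_combination hz - c * hab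
  have hx0 := mul_nonneg ha.le (sub_nonneg.2 (h x hx))
  have hy0 := mul_nonneg hb.le (sub_nonneg.2 (h y hy))
  exact sub_eq_zero.1 ((mul_eq_zero.1 (by linarith)).resolve_left ha.ne')

theorem eq_left_of_mem_segment (L : E →ₗ[ℝ] ℝ) {x p q : E} (hpq : L p ≠ L q)
    (hx : x ∈ segment ℝ p q) (hL : L x = L p) : x = p := by
  obtain ⟨a, b, -, -, hab, rfl⟩ := hx
  obtain rfl : a = 1 - b := eq_sub_of_add_eq hab
  have hb : b * (L q - L p) = 0 := by
    rw [map_add, map_smul, map_smul, smul_eq_mul, smul_eq_mul] at hL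
    linarith
  rw [(mul_eq_zero.1 hb).resolve_right (sub_ne_zero.2 hpq.symm)]
  simp

theorem left_mem_extremePoints_segment (L : E →ₗ[ℝ] ℝ) {p q : E} (hpq : L p < L q) :
    p ∈ (segment ℝ p q).extremePoints ℝ := by
  have hle : ∀ x ∈ segment ℝ p q, L p ≤ L x := fun x hx =>
    (convex_halfSpace_ge L.isLinear (L p)).segment_subset (le_refl (L p)) hpq.le hx
  have hlevel : {x ∈ segment ℝ p q | L x = L p} = {p} :=
    Set.Subset.antisymm (fun x hx => eq_left_of_mem_segment L hpq.ne hx.1 hx.2)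
      (Set.singleton_subset_iff.2 ⟨left_mem_segment .., rfl⟩)
  exact isExtreme_singleton.1 (hlevel ▸ isExtreme_level L hle)

theorem pair_subset_extremePoints_segment (L : E →ₗ[ℝ] ℝ) {p q : E} (hpq : L p < L q) :
    {p, q} ⊆ (segment ℝ p q).extremePoints ℝ := by
  refine Set.pair_subset (left_mem_extremePoints_segment L hpq) ?_
  rw [segment_symm]
  exact left_mem_extremePoints_segment (-L) (neg_lt_neg hpq)

theorem convexHull_level (L : E →ₗ[ℝ] ℝ) {X : Set E} {c : ℝ} (h : ∀ x ∈ X, c ≤ L x) :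
    {x ∈ convexHull ℝ X | L x = c} = convexHull ℝ {x ∈ X | L x = c} := by
  have hhalf : Convex ℝ {x | c ≤ L x} := convex_halfSpace_ge L.isLinear c
  refine Set.Subset.antisymm (fun x hx => ?_) (convexHull_min
    (Set.inter_subset_inter_left _ (subset_convexHull ℝ X))
    ((convex_convexHull ℝ X).inter (convex_hyperplane L.isLinear c)))
  suffices hconv : Convex ℝ {x | c ≤ L x ∧ (L x = c → x ∈ convexHull ℝ {x ∈ X | L x = c})} by
    refine (convexHull_min (fun y hy => ?_) hconv hx.1).2 hx.2
    exact ⟨h y hy, fun hc => subset_convexHull ℝ _ ⟨hy, hc⟩⟩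
  rw [convex_iff_openSegment_subset]
  intro x hx y hy z hz
  have hzc : c ≤ L z := hhalf.openSegment_subset hx.1 hy.1 hz
  refine ⟨hzc, fun hc => ?_⟩
  have hext := isExtreme_level L (S := {x | c ≤ L x}) fun _ hx => hx
  exact (convex_convexHull ℝ _).openSegment_subset
    (hx.2 (hext.left_mem_of_mem_openSegment hx.1 hy.1 ⟨hzc, hc⟩ hz).2)
    (hy.2 (hext.right_mem_of_mem_openSegment hx.1 hy.1 ⟨hzc, hc⟩ hz).2) hz

theorem vectorSpan_convexHull (s : Set E) : vectorSpan ℝ (convexHull ℝ s) = vectorSpan ℝ s := by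
  rw [← direction_affineSpan, affineSpan_convexHull, direction_affineSpan]

theorem vectorSpan_insert_zero (s : Set E) : vectorSpan ℝ (insert 0 s) = Submodule.span ℝ s := by
  rw [vectorSpan_eq_span_vsub_set_right ℝ (Set.mem_insert 0 s)]
  simp

theorem vectorSpan_le_ker (L : E →ₗ[ℝ] ℝ) {s : Set E} {c : ℝ} (h : ∀ x ∈ s, L x = c) :
    vectorSpan ℝ s ≤ LinearMap.ker L := by
  refine Submodule.span_le.2 ?_
  rintro _ ⟨x, hx, y, hy, rfl⟩
  simp [h x hx, h y hy]

theorem finrank_vectorSpan_insert [FiniteDimensional ℝ E] (L : E →ₗ[ℝ] ℝ) {s : Set E} {c : ℝ}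
    (hs : s.Nonempty) (h : ∀ x ∈ s, L x = c) {p : E} (hp : L p ≠ c) :
    Module.finrank ℝ (vectorSpan ℝ (insert p s)) = Module.finrank ℝ (vectorSpan ℝ s) + 1 := by
  refine le_antisymm (finrank_vectorSpan_insert_le_set ℝ s p)
    (Submodule.finrank_lt_finrank_of_lt ?_)
  obtain ⟨x, hx⟩ := hs
  refine lt_of_le_of_ne (vectorSpan_mono ℝ (Set.subset_insert p s)) fun heq => ?_
  have hmem : p - x ∈ vectorSpan ℝ s := heq ▸
    vsub_mem_vectorSpan ℝ (Set.mem_insert p s) (Set.mem_insert_of_mem p hx)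
  have hker := vectorSpan_le_ker L h hmem
  rw [LinearMap.mem_ker, map_sub, h x hx, sub_eq_zero] at hker
  exact hp hker

/-- `X` is the union of the point `W` of the hyperplane `L = 1` and a subset of the hyperplane
`L = 0`, so that its convex hull is a pyramid with apex `W`. -/
structure IsPyramid (L : E →ₗ[ℝ] ℝ) (W : E) (X : Set E) : Prop where
  apex_mem : W ∈ X
  apply_apex : L W = 1
  apply_eq_zero : ∀ x ∈ X, x ≠ W → L x = 0

namespace IsPyramid

variable {L : E →ₗ[ℝ] ℝ} {W : E} {X : Set E}

theorem apply_nonneg_of_mem (h : IsPyramid L W X) : ∀ x ∈ X, 0 ≤ L x := fun x hx => by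
  rcases eq_or_ne x W with rfl | hne
  · rw [h.apply_apex]; exact zero_le_one
  · exact (h.apply_eq_zero x hx hne).ge

theorem apply_nonneg (h : IsPyramid L W X) : ∀ x ∈ convexHull ℝ X, 0 ≤ L x := fun _ hx =>
  convexHull_min h.apply_nonneg_of_mem (convex_halfSpace_ge L.isLinear 0) hx

theorem apply_le_one_of_mem (h : IsPyramid L W X) : ∀ x ∈ X, L x ≤ 1 := fun x hx => by
  rcases eq_or_ne x W with rfl | hne
  · exact h.apply_apex.le
  · rw [h.apply_eq_zero x hx hne]; exact zero_le_one

theorem apply_le_one (h : IsPyramid L W X) : ∀ x ∈ convexHull ℝ X, L x ≤ 1 := fun _ hx =>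
  convexHull_min h.apply_le_one_of_mem (convex_halfSpace_le L.isLinear 1) hx

theorem insert_apex_base (h : IsPyramid L W X) : insert W {x ∈ X | L x = 0} = X := by
  refine Set.Subset.antisymm (Set.insert_subset h.apex_mem (Set.sep_subset ..)) fun x hx => ?_
  exact or_iff_not_imp_left.2 fun hne => ⟨hx, h.apply_eq_zero x hx hne⟩

theorem top_level (h : IsPyramid L W X) : {x ∈ convexHull ℝ X | L x = 1} = {W} := by
  have htop : {x ∈ X | (-L) x = -1} = {W} := by
    ext x
    simp only [LinearMap.neg_apply, neg_inj, Set.mem_sep_iff, Set.mem_singleton_iff]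
    refine ⟨fun ⟨hx, hL⟩ => ?_, fun hx => hx ▸ ⟨h.apex_mem, h.apply_apex⟩⟩
    exact of_not_not fun hne => zero_ne_one ((h.apply_eq_zero x hx hne).symm.trans hL)
  have hlevel := convexHull_level (-L) fun x hx => neg_le_neg (h.apply_le_one_of_mem x hx)
  rw [htop, convexHull_singleton] at hlevel
  simpa only [LinearMap.neg_apply, neg_inj] using hlevel

theorem eq_apex (h : IsPyramid L W X) {x : E} (hx : x ∈ convexHull ℝ X) (hL : L x = 1) : x = W :=
  h.top_level.subset ⟨hx, hL⟩

theorem apex_mem_extremePoints (h : IsPyramid L W X) : W ∈ (convexHull ℝ X).extremePoints ℝ := by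
  have hext := isExtreme_level (-L) fun x hx => neg_le_neg (h.apply_le_one x hx)
  simp only [LinearMap.neg_apply, neg_inj, h.top_level] at hext
  exact isExtreme_singleton.1 hext

theorem extremePoints_base (h : IsPyramid L W X) :
    {x ∈ convexHull ℝ X | L x = 0}.extremePoints ℝ = (convexHull ℝ X).extremePoints ℝ \ {W} := by
  rw [(isExtreme_level L h.apply_nonneg).extremePoints_eq]
  ext x
  refine ⟨fun ⟨⟨_, hL⟩, hx⟩ => ⟨hx, fun hxW => ?_⟩, fun ⟨hx, hne⟩ => ⟨⟨hx.1, ?_⟩, hx⟩⟩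
  · rw [Set.mem_singleton_iff.1 hxW, h.apply_apex] at hL
    exact one_ne_zero hL
  · exact h.apply_eq_zero x (extremePoints_convexHull_subset hx) hne

theorem base_nonempty (h : IsPyramid L W X) (hX : Module.finrank ℝ (vectorSpan ℝ X) ≠ 0) :
    {x ∈ X | L x = 0}.Nonempty := by
  rw [Set.nonempty_iff_ne_empty]
  intro hempty
  rw [← h.insert_apex_base, hempty, insert_empty_eq, vectorSpan_singleton, finrank_bot] at hX
  exact hX rfl

theorem finrank_vectorSpan [FiniteDimensional ℝ E] (h : IsPyramid L W X)
    (hbase : {x ∈ X | L x = 0}.Nonempty) :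
    Module.finrank ℝ (vectorSpan ℝ X) = Module.finrank ℝ (vectorSpan ℝ {x ∈ X | L x = 0}) + 1 := by
  rw [← finrank_vectorSpan_insert L hbase (fun _ hx => hx.2) (h.apply_apex.trans_ne one_ne_zero),
    h.insert_apex_base]

end IsPyramid

end ConvexLevel

/-! ### The Newton polyhedron -/

section NewtonPolyhedron

variable {n : ℕ}

/-- The lattice point `ν` as a point of Euclidean space. -/
noncomputable def latticePoint (ν : Fin n → ℕ) : EuclideanSpace ℝ (Fin n) :=
  WithLp.toLp 2 fun i => (ν i : ℝ)

theorem latticePoint_apply (ν : Fin n → ℕ) (i : Fin n) : latticePoint ν i = ν i := rfl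

theorem latticePoint_injective : Function.Injective (latticePoint (n := n)) := fun _ _ h =>
  funext fun i => Nat.cast_injective (R := ℝ) (congrArg (fun x => x i) h)

/-- The linear form `⟨u, ·⟩`. -/
noncomputable def weightForm (u : Fin n → ℝ) : EuclideanSpace ℝ (Fin n) →ₗ[ℝ] ℝ :=
  innerₗ _ (WithLp.toLp 2 u)

theorem weightForm_apply (u : Fin n → ℝ) (x : EuclideanSpace ℝ (Fin n)) :
    weightForm u x = ∑ i, u i * x i := by
  simp [weightForm, PiLp.inner_apply, mul_comm]

theorem weightForm_latticePoint (u : Fin n → ℝ) (ν : Fin n → ℕ) :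
    weightForm u (latticePoint ν) = latticeWeight u ν :=
  weightForm_apply ..

theorem weightForm_single (u : Fin n → ℝ) (i : Fin n) (t : ℝ) :
    weightForm u (EuclideanSpace.single i t) = u i * t := by
  simp [weightForm_apply]

/-- The `j`-th coordinate. -/
noncomputable def coordForm (j : Fin n) : EuclideanSpace ℝ (Fin n) →ₗ[ℝ] ℝ :=
  weightForm (Pi.single j 1)

theorem coordForm_apply (j : Fin n) (x : EuclideanSpace ℝ (Fin n)) : coordForm j x = x j := by
  simp [coordForm, weightForm_apply, Pi.single_apply]

theorem coordForm_latticePoint (j : Fin n) (ν : Fin n → ℕ) :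
    coordForm j (latticePoint ν) = ν j :=
  coordForm_apply ..

/-- The union of the orthants `ν + ℝ₊ⁿ`, `ν ∈ A`. -/
def latticeUpperSet (A : Set (Fin n → ℕ)) : Set (EuclideanSpace ℝ (Fin n)) :=
  {x | ∃ ν ∈ A, ∀ i, (ν i : ℝ) ≤ x i}

/-- The Newton polyhedron of a set of exponents; the Newton diagram of `f` is the case of the
exponents of the monomials in its Taylor series. -/
def newtonPolyhedron (A : Set (Fin n → ℕ)) : Set (EuclideanSpace ℝ (Fin n)) :=
  convexHull ℝ (latticeUpperSet A)

/-- The convex hull of the points of `F` on the hyperplane `⟨u, ·⟩ = c`: a compact face of the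
Newton polyhedron of `F` if `u` is a supporting weight at level `c`. -/
noncomputable def weightFace (F : Set (Fin n → ℕ)) (u : Fin n → ℝ) (c : ℝ) :
    Set (EuclideanSpace ℝ (Fin n)) :=
  convexHull ℝ (latticePoint '' activePoints F u c)

variable {A F : Set (Fin n → ℕ)} {u : Fin n → ℝ} {c : ℝ}

theorem newtonPolyhedron_eq_of_forall_exists_le (hFA : F ⊆ A) (h : ∀ ν ∈ A, ∃ μ ∈ F, μ ≤ ν) :
    newtonPolyhedron A = newtonPolyhedron F := by
  refine congrArg (convexHull ℝ) (Set.Subset.antisymm ?_ ?_)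
  · rintro x ⟨ν, hν, hx⟩
    obtain ⟨μ, hμ, hμν⟩ := h ν hν
    exact ⟨μ, hμ, fun i => (Nat.cast_le.2 (hμν i)).trans (hx i)⟩
  · rintro x ⟨ν, hν, hx⟩
    exact ⟨ν, hFA hν, hx⟩

theorem exists_finite_subset_forall_exists_le (A : Set (Fin n → ℕ)) :
    ∃ F ⊆ A, F.Finite ∧ ∀ ν ∈ A, ∃ μ ∈ F, μ ≤ ν := by
  refine ⟨{ν | Minimal (· ∈ A) ν}, fun ν hν => hν.prop, ?_, fun ν hν => ?_⟩
  · exact (setOfPred_minimal_antichain _).finite_of_partiallyWellOrderedOn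
      (Set.isPWO_of_wellQuasiOrderedLE _)
  · obtain ⟨μ, hμν, hμ⟩ := exists_minimal_le_of_wellFoundedLT (· ∈ A) ν hν
    exact ⟨μ, hμ, hμν⟩

theorem latticePoint_mem_newtonPolyhedron {ν : Fin n → ℕ} (hν : ν ∈ A) :
    latticePoint ν ∈ newtonPolyhedron A :=
  subset_convexHull ℝ _ ⟨ν, hν, fun _ => le_rfl⟩

theorem latticeWeight_le_weightForm (hu : ∀ i, 0 ≤ u i) {x : EuclideanSpace ℝ (Fin n)}
    {ν : Fin n → ℕ} (h : ∀ i, (ν i : ℝ) ≤ x i) : latticeWeight u ν ≤ weightForm u x := by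
  rw [weightForm_apply]
  exact dotProduct_le_dotProduct_of_nonneg_left h hu

theorem le_weightForm_of_mem_newtonPolyhedron (hu : ∀ i, 0 ≤ u i)
    (hc : ∀ ν ∈ A, c ≤ latticeWeight u ν) :
    ∀ x ∈ newtonPolyhedron A, c ≤ weightForm u x := by
  refine fun x hx => convexHull_min ?_ (convex_halfSpace_ge (weightForm u).isLinear c) hx
  rintro y ⟨ν, hν, hy⟩
  exact (hc ν hν).trans (latticeWeight_le_weightForm hu hy)

theorem add_single_mem_newtonPolyhedron {x : EuclideanSpace ℝ (Fin n)}
    (hx : x ∈ newtonPolyhedron A) (i : Fin n) {t : ℝ} (ht : 0 ≤ t) :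
    x + EuclideanSpace.single i t ∈ newtonPolyhedron A := by
  have hconv : Convex ℝ ((fun x => x + EuclideanSpace.single i t) ⁻¹' newtonPolyhedron A) :=
    (convex_convexHull ℝ _).translate_preimage_left _
  refine convexHull_min ?_ hconv hx
  rintro y ⟨ν, hν, hy⟩
  refine subset_convexHull ℝ _ ⟨ν, hν, fun j => (hy j).trans ?_⟩
  rcases eq_or_ne j i with rfl | h <;> simp [*]

theorem level_latticeUpperSet (hu : IsSupportingWeight F u c) :
    {x ∈ latticeUpperSet F | weightForm u x = c} = latticePoint '' activePoints F u c := by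
  ext x
  constructor
  · rintro ⟨⟨ν, hν, hνx⟩, hx⟩
    have hνc : latticeWeight u ν = c := le_antisymm
      ((latticeWeight_le_weightForm (fun i => (hu.pos i).le) hνx).trans_eq hx) (hu.le ν hν)
    have hsum : ∑ i, u i * (x i - ν i) = 0 := by
      simp only [mul_sub, Finset.sum_sub_distrib]
      rw [← weightForm_apply, hx, ← hνc, latticeWeight, dotProduct, sub_self]
    rw [Finset.sum_eq_zero_iff_of_nonneg
      fun i _ => mul_nonneg (hu.pos i).le (sub_nonneg.2 (hνx i))] at hsum
    refine ⟨ν, ⟨hν, hνc⟩, PiLp.ext fun i => ?_⟩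
    have hxi := (mul_eq_zero.1 (hsum i (Finset.mem_univ i))).resolve_left (hu.pos i).ne'
    exact (sub_eq_zero.1 hxi).symm
  · rintro ⟨ν, ⟨hν, h⟩, rfl⟩
    exact ⟨⟨ν, hν, fun _ => le_rfl⟩, by rw [weightForm_latticePoint, h]⟩

theorem level_newtonPolyhedron (hu : IsSupportingWeight F u c) :
    {x ∈ newtonPolyhedron F | weightForm u x = c} = weightFace F u c := by
  rw [weightFace, ← level_latticeUpperSet hu]
  refine convexHull_level _ fun x hx => ?_
  exact le_weightForm_of_mem_newtonPolyhedron (fun i => (hu.pos i).le) hu.le x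
    (subset_convexHull ℝ _ hx)

theorem supportValue_le (hu : ∀ i, 0 ≤ u i) {x : EuclideanSpace ℝ (Fin n)}
    (hx : x ∈ newtonPolyhedron A) :
    supportValue (WithLp.toLp 2 u) (newtonPolyhedron A) ≤ weightForm u x := by
  refine csInf_le ⟨0, ?_⟩ ⟨x, hx, rfl⟩
  rintro _ ⟨y, hy, rfl⟩
  exact le_weightForm_of_mem_newtonPolyhedron hu (fun ν _ => latticeWeight_nonneg hu ν) y hy

theorem isSupportingWeight_supportValue (hu : ∀ i, 0 < u i) :
    IsSupportingWeight A u (supportValue (WithLp.toLp 2 u) (newtonPolyhedron A)) where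
  pos := hu
  le ν hν := (supportValue_le (fun i => (hu i).le)
    (latticePoint_mem_newtonPolyhedron hν)).trans_eq (weightForm_latticePoint u ν)

-- If `u i = 0`, the face is invariant under translations in the direction of `eᵢ`.
theorem pos_of_isCompact_supportFace (hu : ∀ i, 0 ≤ u i)
    (hcomp : IsCompact (supportFace (WithLp.toLp 2 u) (newtonPolyhedron A)))
    (hne : (supportFace (WithLp.toLp 2 u) (newtonPolyhedron A)).Nonempty) : ∀ i, 0 < u i := by
  refine fun i => (hu i).lt_of_ne fun hi => ?_
  obtain ⟨x, hx, hxu : weightForm u x = _⟩ := hne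
  obtain ⟨C, hC⟩ := hcomp.isBounded.exists_norm_le
  have ht : 0 ≤ |C - x i| + 1 := by positivity
  have hmem : x + EuclideanSpace.single i (|C - x i| + 1) ∈
      supportFace (WithLp.toLp 2 u) (newtonPolyhedron A) := by
    refine ⟨add_single_mem_newtonPolyhedron hx i ht, ?_⟩
    change weightForm u _ = _
    rw [map_add, weightForm_single, ← hi, zero_mul, add_zero, hxu]
  have hle := (le_abs_self _).trans ((PiLp.norm_apply_le _ i).trans (hC _ hmem))
  simp only [PiLp.add_apply, PiLp.single_apply, if_true] at hle
  linarith [le_abs_self (C - x i)]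

theorem weightFace_nonempty_iff : (weightFace F u c).Nonempty ↔ (activePoints F u c).Nonempty := by
  rw [weightFace, convexHull_nonempty_iff, Set.image_nonempty]

theorem supportFace_eq_weightFace (hu : IsSupportingWeight F u c)
    (hne : (activePoints F u c).Nonempty) :
    supportFace (WithLp.toLp 2 u) (newtonPolyhedron F) = weightFace F u c := by
  have hval : supportValue (WithLp.toLp 2 u) (newtonPolyhedron F) = c := by
    obtain ⟨ν, hν, hνc⟩ := hne
    refine IsLeast.csInf_eq ⟨⟨_, latticePoint_mem_newtonPolyhedron hν,
      (weightForm_latticePoint u ν).trans hνc⟩, ?_⟩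
    rintro _ ⟨y, hy, rfl⟩
    exact le_weightForm_of_mem_newtonPolyhedron (fun i => (hu.pos i).le) hu.le y hy
  rw [supportFace, hval, ← level_newtonPolyhedron hu]
  rfl

theorem mem_newtonBoundary_iff [NeZero n] {f : (Fin n → ℂ) → ℂ} (hfin : F.Finite)
    (hF : newtonDiagram f = newtonPolyhedron F) {S : Set (EuclideanSpace ℝ (Fin n))}
    (hS : S.Nonempty) :
    S ∈ newtonBoundary f ↔ ∃ u c, IsSupportingWeight F u c ∧ S = weightFace F u c := by
  rw [newtonBoundary, hF]
  constructor
  · rintro ⟨hcomp, u, hu, -, rfl⟩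
    have hsupp := isSupportingWeight_supportValue (A := F)
      (pos_of_isCompact_supportFace hu hcomp hS)
    exact ⟨u.ofLp, _, hsupp, level_newtonPolyhedron hsupp⟩
  · rintro ⟨u, c, hu, rfl⟩
    have hcomp : IsCompact (weightFace F u c) :=
      ((hfin.subset (Set.sep_subset ..)).image _).isCompact_convexHull ℝ
    refine ⟨hcomp, WithLp.toLp 2 u, fun i => (hu.pos i).le, fun h => (hu.pos 0).ne' ?_,
      (supportFace_eq_weightFace hu (weightFace_nonempty_iff.1 hS)).symm⟩
    exact congrArg (fun x : EuclideanSpace ℝ (Fin n) => x 0) h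

theorem mem_compactFaces_iff [NeZero n] {f : (Fin n → ℂ) → ℂ} (hfin : F.Finite)
    (hF : newtonDiagram f = newtonPolyhedron F) {k : ℕ} (hk : k ≠ 0)
    {S : Set (EuclideanSpace ℝ (Fin n))} :
    S ∈ compactFaces f k ↔ (∃ u c, IsSupportingWeight F u c ∧ S = weightFace F u c) ∧
      Module.finrank ℝ (vectorSpan ℝ S) = k := by
  refine and_congr_left fun hdim => mem_newtonBoundary_iff hfin hF ?_
  rw [Set.nonempty_iff_ne_empty]
  rintro rfl
  rw [vectorSpan_empty, finrank_bot] at hdim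
  exact hk hdim.symm

end NewtonPolyhedron

/-! ### Exceptional faces -/

theorem infDist_coordAxis {n : ℕ} (x : EuclideanSpace ℝ (Fin n)) (i : Fin n) :
    Metric.infDist x (coordAxis i) = √(∑ j ∈ Finset.univ.erase i, x j ^ 2) := by
  have hmem : EuclideanSpace.single i (x i) ∈ coordAxis i := fun j hj => by simp [hj]
  have hdist (y : EuclideanSpace ℝ (Fin n)) (hy : y ∈ coordAxis i) :
      dist x y = √((x i - y i) ^ 2 + ∑ j ∈ Finset.univ.erase i, x j ^ 2) := by
    simp only [EuclideanSpace.dist_eq, Real.dist_eq, sq_abs]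
    rw [← Finset.add_sum_erase _ _ (Finset.mem_univ i)]
    refine congrArg (fun s => √((x i - y i) ^ 2 + s)) (Finset.sum_congr rfl fun j hj => ?_)
    rw [hy j (Finset.ne_of_mem_erase hj), sub_zero]
  refine le_antisymm ((Metric.infDist_le_dist_of_mem hmem).trans_eq ?_)
    ((Metric.le_infDist ⟨_, hmem⟩).2 fun y hy => ?_)
  · simp [hdist _ hmem]
  · rw [hdist y hy]
    exact Real.sqrt_le_sqrt (le_add_of_nonneg_left (sq_nonneg _))

theorem infDist_latticePoint_coordAxis_eq_one_iff {n : ℕ} {ω : Fin n → ℕ} {i j : Fin n}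
    (hji : j ≠ i) (hj : ω j ≠ 0) :
    Metric.infDist (latticePoint ω) (coordAxis i) = 1 ↔
      ω j = 1 ∧ ∀ l, l ≠ i → l ≠ j → ω l = 0 := by
  have hsplit : Metric.infDist (latticePoint ω) (coordAxis i) = 1 ↔
      ω j ^ 2 + ∑ l ∈ (Finset.univ.erase i).erase j, ω l ^ 2 = 1 := by
    rw [infDist_coordAxis, Real.sqrt_eq_one,
      ← Finset.add_sum_erase _ _ (Finset.mem_erase.2 ⟨hji, Finset.mem_univ j⟩)]
    simp only [latticePoint_apply]
    exact_mod_cast Iff.rfl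
  have hrest : (∑ l ∈ (Finset.univ.erase i).erase j, ω l ^ 2 = 0) ↔
      ∀ l, l ≠ i → l ≠ j → ω l = 0 := by
    simp only [Finset.sum_eq_zero_iff, Finset.mem_erase, Finset.mem_univ, and_true,
      pow_eq_zero_iff two_ne_zero]
    exact forall_congr' fun l => ⟨fun h hi hj => h ⟨hj, hi⟩, fun h ⟨hj, hi⟩ => h hi hj⟩
  have hpos : ω j ^ 2 ≠ 0 := pow_ne_zero 2 hj
  have hone : ω j ^ 2 = 1 ↔ ω j = 1 := by simp
  rw [hsplit, ← hrest, ← hone]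
  omega

theorem IsSupportingWeight.add_single {n : ℕ} {F : Set (Fin n → ℕ)} {w : Fin n → ℝ} {d : ℝ}
    (hw : IsSupportingWeight F w d) (j : Fin n) : IsSupportingWeight F (w + Pi.single j 1) d where
  pos m := add_pos_of_pos_of_nonneg (hw.pos m)
    ((Pi.single_nonneg.2 zero_le_one : (0 : Fin n → ℝ) ≤ Pi.single j 1) m)
  le ν hν := by
    rw [add_latticeWeight, single_latticeWeight]
    exact le_add_of_le_of_nonneg (hw.le ν hν) (Nat.cast_nonneg _)

theorem IsSupportingWeight.activePoints_add_single {n : ℕ} {F : Set (Fin n → ℕ)} {w : Fin n → ℝ}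
    {d : ℝ} (hw : IsSupportingWeight F w d) (j : Fin n) :
    activePoints F (w + Pi.single j 1) d = {ν ∈ activePoints F w d | ν j = 0} := by
  ext ν
  simp only [activePoints, Set.mem_sep_iff, add_latticeWeight, single_latticeWeight, and_assoc]
  refine and_congr_right fun hν => ⟨fun h => ?_, fun ⟨h, h0⟩ => by simp [h, h0]⟩
  have hj : (ν j : ℝ) = 0 := le_antisymm (by linarith [hw.le ν hν]) (Nat.cast_nonneg _)
  exact ⟨by rw [← h, hj, add_zero], Nat.cast_eq_zero.1 hj⟩

theorem IsSupportingWeight.weightFace_add_single {n : ℕ} {F : Set (Fin n → ℕ)} {w : Fin n → ℝ}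
    {d : ℝ} (hw : IsSupportingWeight F w d) (j : Fin n) :
    weightFace F (w + Pi.single j 1) d = {x ∈ weightFace F w d | coordForm j x = 0} := by
  rw [weightFace, weightFace, convexHull_level, hw.activePoints_add_single]
  · congr 1
    ext x
    constructor
    · rintro ⟨ν, ⟨hν, hj⟩, rfl⟩
      exact ⟨⟨ν, hν, rfl⟩, by rw [coordForm_latticePoint, hj, Nat.cast_zero]⟩
    · rintro ⟨⟨ν, hν, rfl⟩, hj⟩
      exact ⟨ν, ⟨hν, by rwa [coordForm_latticePoint, Nat.cast_eq_zero] at hj⟩, rfl⟩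
  · rintro _ ⟨ν, -, rfl⟩
    rw [coordForm_latticePoint]
    exact Nat.cast_nonneg _

theorem span_latticePoint_eq_top {n : ℕ} {G : Set (Fin n → ℕ)}
    (h : ∀ v : Fin n → ℝ, (∀ ν ∈ G, latticeWeight v ν = 0) → v = 0) :
    Submodule.span ℝ (latticePoint '' G) = ⊤ := by
  rw [← Submodule.orthogonal_eq_bot_iff, Submodule.eq_bot_iff]
  intro v hv
  refine (WithLp.ofLp_eq_zero 2).1 (h v.ofLp fun ν hν => ?_)
  rw [← weightForm_latticePoint]
  exact Submodule.mem_orthogonal' _ v |>.1 hv _ (Submodule.subset_span ⟨ν, hν, rfl⟩)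

theorem finrank_vectorSpan_weightFace_of_span {n : ℕ} {F : Set (Fin (n + 1) → ℕ)}
    {u : Fin (n + 1) → ℝ} {c : ℝ} (hc : c ≠ 0)
    (h : ∀ v : Fin (n + 1) → ℝ, (∀ ν ∈ activePoints F u c, latticeWeight v ν = 0) → v = 0) :
    Module.finrank ℝ (vectorSpan ℝ (weightFace F u c)) = n := by
  have hne : (activePoints F u c).Nonempty := by
    by_contra hempty
    rw [Set.not_nonempty_iff_eq_empty] at hempty
    exact one_ne_zero (h 1 (by simp [hempty]))
  have hinsert := finrank_vectorSpan_insert (weightForm u) (hne.image latticePoint) (c := c)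
    (p := 0) (by rintro _ ⟨ν, hν, rfl⟩; rw [weightForm_latticePoint, hν.2])
    (by rwa [map_zero, ne_comm])
  rw [vectorSpan_insert_zero, span_latticePoint_eq_top h, finrank_top,
    finrank_euclideanSpace_fin] at hinsert
  rw [weightFace, vectorSpan_convexHull]
  omega

-- Otherwise the face spans an affine subspace of codimension at least `2`: add to it the point
-- `x + uᵢ eⱼ - uⱼ eᵢ` of the supporting hyperplane and then a point outside of that hyperplane.
theorem IsSupportingWeight.exists_mem_activePoints_ne_zero {n : ℕ} {F : Set (Fin (n + 2) → ℕ)}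
    {u : Fin (n + 2) → ℝ} {c : ℝ} (hu : IsSupportingWeight F u c)
    (hdim : Module.finrank ℝ (vectorSpan ℝ (weightFace F u c)) = n + 1) (j : Fin (n + 2)) :
    ∃ ν ∈ activePoints F u c, ν j ≠ 0 := by
  by_contra! h
  rw [weightFace, vectorSpan_convexHull] at hdim
  set X := latticePoint '' activePoints F u c with hX
  have hXu : ∀ x ∈ X, weightForm u x = c := by
    rintro _ ⟨ν, hν, rfl⟩
    rw [weightForm_latticePoint, hν.2]
  have hXj : ∀ x ∈ X, coordForm j x = 0 := by
    rintro _ ⟨ν, hν, rfl⟩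
    rw [coordForm_latticePoint, h ν hν, Nat.cast_zero]
  obtain ⟨x, hx⟩ : X.Nonempty := by
    rw [Set.nonempty_iff_ne_empty]
    intro hempty
    rw [hempty, vectorSpan_empty, finrank_bot] at hdim
    omega
  obtain ⟨i, hij⟩ := exists_ne j
  set p := x + EuclideanSpace.single j (u i) - EuclideanSpace.single i (u j) with hp
  have hpu : weightForm u p = c := by
    rw [hp, map_sub, map_add, weightForm_single, weightForm_single, hXu x hx]
    ring
  have hpj : coordForm j p ≠ 0 := by
    have hxj := hXj x hx
    rw [coordForm_apply] at hxj ⊢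
    simp [hp, hxj, hij.symm, (hu.pos i).ne']
  have hqu : weightForm u (x + EuclideanSpace.single j 1) ≠ c := by
    rw [map_add, weightForm_single, hXu x hx]
    simp [(hu.pos j).ne']
  have hinsert := finrank_vectorSpan_insert (weightForm u) (Set.insert_nonempty p X)
    (by simpa [hpu] using hXu) hqu
  rw [finrank_vectorSpan_insert (coordForm j) ⟨x, hx⟩ hXj hpj, hdim] at hinsert
  have hle := (vectorSpan ℝ (insert (x + EuclideanSpace.single j 1) (insert p X))).finrank_le
  rw [finrank_euclideanSpace_fin] at hle
  omega

theorem IsPyramid.eq_apex_or_apply_eq_zero {n : ℕ} {j : Fin n} {W : EuclideanSpace ℝ (Fin n)}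
    {X : Set (EuclideanSpace ℝ (Fin n))} (h : IsPyramid (coordForm j) W X) {ν : Fin n → ℕ}
    (hν : latticePoint ν ∈ convexHull ℝ X) : latticePoint ν = W ∨ ν j = 0 := by
  have hle := h.apply_le_one _ hν
  rw [coordForm_latticePoint, Nat.cast_le_one, Nat.le_one_iff_eq_zero_or_eq_one] at hle
  rcases hle with h0 | h1
  · exact Or.inr h0
  · exact Or.inl (h.eq_apex hν (by rw [coordForm_latticePoint, h1, Nat.cast_one]))

theorem convexHull_extremePoints_weightFace {n : ℕ} {F : Set (Fin n → ℕ)} (hfin : F.Finite)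
    (u : Fin n → ℝ) (c : ℝ) :
    convexHull ℝ ((weightFace F u c).extremePoints ℝ) = weightFace F u c := by
  have hX : (latticePoint '' activePoints F u c).Finite :=
    (hfin.subset (Set.sep_subset ..)).image _
  have hext := hX.subset (extremePoints_convexHull_subset (𝕜 := ℝ))
  rw [weightFace, ← (hext.isClosed_convexHull ℝ).closure_eq]
  exact closure_convexHull_extremePoints (hX.isCompact_convexHull ℝ) (convex_convexHull ..)

section ExceptionalFace

variable {n : ℕ} {f : (Fin (n + 2) → ℂ) → ℂ} {F : Set (Fin (n + 2) → ℕ)} {w : Fin (n + 2) → ℝ}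
  {d : ℝ}

theorem hasExceptionalApex_of_mem_exceptionalFaces (hfin : F.Finite)
    (hplane : ∀ j, ∃ ν ∈ activePoints F w d, ν j ≠ 0) (h : weightFace F w d ∈ exceptionalFaces f) :
    HasExceptionalApex (activePoints F w d) := by
  obtain ⟨i, -, W, hW, hdist, T, -, hT, j, hji, hTj⟩ := h
  obtain ⟨ω, hω, rfl⟩ := extremePoints_convexHull_subset hW
  have hbase : ∀ x ∈ (weightFace F w d).extremePoints ℝ, x ≠ latticePoint ω →
      coordForm j x = 0 := by
    intro x hx hne
    have hxT : x ∈ T.extremePoints ℝ := hT ▸ ⟨hx, hne⟩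
    rw [coordForm_apply]
    exact hTj hxT.1
  have hωj : ω j ≠ 0 := by
    intro h0
    obtain ⟨ν, hν, hνj⟩ := hplane j
    refine hνj (Nat.cast_eq_zero.1 ((coordForm_latticePoint j ν).symm.trans ?_))
    have hmem := subset_convexHull ℝ _ (Set.mem_image_of_mem latticePoint hν)
    rw [← weightFace, ← convexHull_extremePoints_weightFace hfin] at hmem
    refine convexHull_min (fun x hx => ?_) (convex_hyperplane (coordForm j).isLinear 0) hmem
    rcases eq_or_ne x (latticePoint ω) with rfl | hne
    · exact (coordForm_latticePoint j ω).trans (by rw [h0, Nat.cast_zero])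
    · exact hbase x hx hne
  obtain ⟨hωj, hωl⟩ := (infDist_latticePoint_coordAxis_eq_one_iff hji hωj).1 hdist
  have hpyr : IsPyramid (coordForm j) (latticePoint ω) ((weightFace F w d).extremePoints ℝ) :=
    ⟨hW, by rw [coordForm_latticePoint, hωj, Nat.cast_one], hbase⟩
  refine ⟨i, j, hji.symm, ω, hω, hωj, hωl, fun ν hν hne => ?_⟩
  refine (hpyr.eq_apex_or_apply_eq_zero ?_).resolve_left (latticePoint_injective.ne hne)
  rw [convexHull_extremePoints_weightFace hfin]
  exact subset_convexHull ℝ _ ⟨ν, hν, rfl⟩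

theorem weightFace_mem_exceptionalFaces (hfin : F.Finite)
    (hF : newtonDiagram f = newtonPolyhedron F) (hw : IsSupportingWeight F w d)
    (hdim : Module.finrank ℝ (vectorSpan ℝ (weightFace F w d)) = n + 1)
    (h : HasExceptionalApex (activePoints F w d)) : weightFace F w d ∈ exceptionalFaces f := by
  obtain ⟨i, j, hij, ω, hω, hωj, hωl, hbase⟩ := h
  have hpyr : IsPyramid (coordForm j) (latticePoint ω) (latticePoint '' activePoints F w d) := by
    refine ⟨⟨ω, hω, rfl⟩, by rw [coordForm_latticePoint, hωj, Nat.cast_one], ?_⟩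
    rintro _ ⟨ν, hν, rfl⟩ hne
    rw [coordForm_latticePoint, hbase ν hν (ne_of_apply_ne _ hne), Nat.cast_zero]
  have hT := hw.weightFace_add_single j
  have hbase_ne : {x ∈ latticePoint '' activePoints F w d | coordForm j x = 0}.Nonempty :=
    hpyr.base_nonempty (by rw [← vectorSpan_convexHull, ← weightFace, hdim]; omega)
  have hTdim : Module.finrank ℝ (vectorSpan ℝ (weightFace F (w + Pi.single j 1) d)) = n := by
    rw [hT, weightFace, convexHull_level _ hpyr.apply_nonneg_of_mem, vectorSpan_convexHull]
    rw [weightFace, vectorSpan_convexHull, hpyr.finrank_vectorSpan hbase_ne] at hdim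
    omega
  have hTne : (weightFace F (w + Pi.single j 1) d).Nonempty := by
    rw [hT]
    exact hbase_ne.mono fun x hx => ⟨subset_convexHull ℝ _ hx.1, hx.2⟩
  refine ⟨i, (mem_compactFaces_iff hfin hF (Nat.succ_ne_zero n)).2 ⟨⟨w, d, hw, rfl⟩, hdim⟩,
    latticePoint ω, hpyr.apex_mem_extremePoints, ?_, weightFace F (w + Pi.single j 1) d,
    ⟨(mem_newtonBoundary_iff hfin hF hTne).2 ⟨_, d, hw.add_single j, rfl⟩, hTdim⟩, ?_, j,
    hij.symm, ?_⟩
  · exact (infDist_latticePoint_coordAxis_eq_one_iff hij.symm (by omega)).2 ⟨hωj, hωl⟩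
  · rw [hT]
    exact hpyr.extremePoints_base
  · rw [hT]
    exact fun x hx => (coordForm_apply j x).symm.trans hx.2

end ExceptionalFace

/-! ### Special edges -/

theorem activePoints_eq_pair {n : ℕ} {F : Set (Fin n → ℕ)} {u : Fin n → ℝ} {c : ℝ} {j : Fin n}
    {κ ω : Fin n → ℕ} (hκ : κ j = 0) (hω : ω j = 1)
    (h : weightFace F u c = segment ℝ (latticePoint κ) (latticePoint ω)) :
    activePoints F u c = {κ, ω} := by
  have hκω : coordForm j (latticePoint κ) < coordForm j (latticePoint ω) := by
    rw [coordForm_latticePoint, coordForm_latticePoint, hκ, hω]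
    exact_mod_cast zero_lt_one
  refine Set.Subset.antisymm (fun ν hν => ?_) ?_
  · have hνseg := h.subset (subset_convexHull ℝ _ (Set.mem_image_of_mem latticePoint hν))
    have hle : coordForm j (latticePoint ν) ≤ coordForm j (latticePoint ω) :=
      (convex_halfSpace_le (coordForm j).isLinear _).segment_subset hκω.le (le_refl (_ : ℝ)) hνseg
    rw [coordForm_latticePoint, coordForm_latticePoint, hω, Nat.cast_le,
      Nat.le_one_iff_eq_zero_or_eq_one] at hle
    refine hle.imp (fun h0 => ?_) fun h1 => ?_
    · refine latticePoint_injective (eq_left_of_mem_segment _ hκω.ne hνseg ?_)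
      rw [coordForm_latticePoint, coordForm_latticePoint, h0, hκ]
    · rw [segment_symm] at hνseg
      refine latticePoint_injective (eq_left_of_mem_segment _ hκω.ne' hνseg ?_)
      rw [coordForm_latticePoint, coordForm_latticePoint, h1, hω]
  · have hext := pair_subset_extremePoints_segment (coordForm j) hκω
    rw [← h] at hext
    exact fun ν hν => latticePoint_injective.mem_set_image.1
      (extremePoints_convexHull_subset (hext (hν.imp (congrArg _) (congrArg _))))

theorem specialSegment_eq (l : Fin 3) (k : ℕ) :
    specialSegment l k =
      segment ℝ (latticePoint (Pi.single l k)) (latticePoint (specialVertex l)) := by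
  rw [specialSegment, segment_symm]
  congr 1 <;> ext i <;> by_cases h : i = l <;> simp [latticePoint_apply, specialVertex, h]

theorem finrank_vectorSpan_segment {E : Type*} [AddCommGroup E] [Module ℝ E] {x y : E}
    (h : x ≠ y) : Module.finrank ℝ (vectorSpan ℝ (segment ℝ x y)) = 1 := by
  rw [← convexHull_pair, vectorSpan_convexHull, vectorSpan_pair,
    finrank_span_singleton (vsub_ne_zero.2 h)]

theorem activePoints_eq_of_weightFace_eq_specialSegment {F : Set (Fin 3 → ℕ)} {u : Fin 3 → ℝ}
    {c : ℝ} {l : Fin 3} {k : ℕ} (h : weightFace F u c = specialSegment l k) :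
    activePoints F u c = {specialVertex l, Pi.single l k} := by
  obtain ⟨j, hjl⟩ := exists_ne l
  rw [specialSegment_eq] at h
  rw [activePoints_eq_pair (by simp [hjl]) (if_neg hjl) h, Set.pair_comm]

theorem weightFace_eq_specialSegment {F : Set (Fin 3 → ℕ)} {u : Fin 3 → ℝ} {c : ℝ} {l : Fin 3}
    {k : ℕ} (h : activePoints F u c = {specialVertex l, Pi.single l k}) :
    weightFace F u c = specialSegment l k := by
  rw [weightFace, h, Set.image_pair, convexHull_pair, segment_symm, specialSegment_eq]

theorem finrank_vectorSpan_specialSegment (l : Fin 3) (k : ℕ) :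
    Module.finrank ℝ (vectorSpan ℝ (specialSegment l k)) = 1 := by
  obtain ⟨j, hjl⟩ := exists_ne l
  rw [specialSegment_eq]
  refine finrank_vectorSpan_segment fun h => ?_
  have hj := congrFun (latticePoint_injective h) j
  rw [specialVertex, if_neg hjl, Pi.single_eq_of_ne hjl] at hj
  exact zero_ne_one hj

theorem compactFaces_one_inter_specialSegments_nonempty_iff {f : (Fin 3 → ℂ) → ℂ}
    {F : Set (Fin 3 → ℕ)} (hfin : F.Finite) (hF : newtonDiagram f = newtonPolyhedron F) :
    (compactFaces f 1 ∩ specialSegments).Nonempty ↔ HasSpecialEdge F := by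
  constructor
  · rintro ⟨_, hI, l, k, hk, rfl⟩
    obtain ⟨⟨u, c, hu, h⟩, -⟩ := (mem_compactFaces_iff hfin hF one_ne_zero).1 hI
    exact ⟨l, k, hk, u, c, hu, activePoints_eq_of_weightFace_eq_specialSegment h.symm⟩
  · rintro ⟨l, k, hk, u, c, hu, h⟩
    exact ⟨specialSegment l k, (mem_compactFaces_iff hfin hF one_ne_zero).2
      ⟨⟨u, c, hu, (weightFace_eq_specialSegment h).symm⟩, finrank_vectorSpan_specialSegment l k⟩,
      l, k, hk, rfl⟩

/-- The exponents of the monomials in the Taylor series of `f`, so that `newtonDiagram f` is by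
definition their Newton polyhedron. -/
def taylorSupport {n : ℕ} (f : (Fin n → ℂ) → ℂ) : Set (Fin n → ℕ) :=
  {ν | taylorCoeff f ν ≠ 0}

theorem compactFaces_two_subset_iff {f : (Fin 3 → ℂ) → ℂ}
    (hf : IsAdmissibleSupport (taylorSupport f)) :
    compactFaces f 2 ⊆ exceptionalFaces f ↔ (compactFaces f 1 ∩ specialSegments).Nonempty := by
  obtain ⟨F, hFsub, hfin, hle⟩ := exists_finite_subset_forall_exists_le (taylorSupport f)
  have hF : newtonDiagram f = newtonPolyhedron F :=
    newtonPolyhedron_eq_of_forall_exists_le hFsub hle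
  rw [compactFaces_one_inter_specialSegments_nonempty_iff hfin hF]
  constructor
  · intro hE
    refine hasSpecialEdge_of_hasExceptionalApex hfin (hf.of_forall_exists_le hFsub hle)
      fun u hu hpos hspan => ?_
    have hsupp : IsSupportingWeight F u 1 := ⟨hpos, hu.2⟩
    have hdim := finrank_vectorSpan_weightFace_of_span one_ne_zero hspan
    exact hasExceptionalApex_of_mem_exceptionalFaces hfin
      (hsupp.exists_mem_activePoints_ne_zero hdim)
      (hE ((mem_compactFaces_iff hfin hF two_ne_zero).2 ⟨⟨u, 1, hsupp, rfl⟩, hdim⟩))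
  · intro hedge S hS
    obtain ⟨⟨w, d, hw, rfl⟩, hdim⟩ := (mem_compactFaces_iff hfin hF two_ne_zero).1 hS
    exact weightFace_mem_exceptionalFaces hfin hF hw hdim
      (hedge.hasExceptionalApex hw (hw.exists_mem_activePoints_ne_zero hdim))

/-! ### Exponents of isolated singularities -/

theorem le_norm_of_forall_mem_sphere_le_norm {g : ℂ → ℂ} {z c : ℂ} {r m : ℝ} (hm : 0 < m)
    (hg : DifferentiableOn ℂ g (Metric.closedBall c r)) (hne : ∀ w ∈ Metric.closedBall c r, g w ≠ 0)
    (hsphere : ∀ w ∈ Metric.sphere c r, m ≤ ‖g w‖) (hz : z ∈ Metric.ball c r) : m ≤ ‖g z‖ := by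
  have hr : r ≠ 0 := (Metric.pos_of_mem_ball hz).ne'
  have hinv : DiffContOnCl ℂ (fun w => (g w)⁻¹) (Metric.ball c r) := by
    refine DifferentiableOn.diffContOnCl ?_
    rw [closure_ball c hr]
    exact hg.inv hne
  have hle : ‖(g z)⁻¹‖ ≤ m⁻¹ := by
    refine Complex.norm_le_of_forall_mem_frontier_norm_le Metric.isBounded_ball hinv
      (fun w hw => ?_) (subset_closure hz)
    rw [frontier_ball c hr] at hw
    rw [norm_inv]
    exact inv_anti₀ hm (hsphere w hw)
  rwa [norm_inv, inv_le_inv₀ (norm_pos_iff.2 (hne z (Metric.ball_subset_closedBall hz))) hm] at hle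

theorem exists_pos_eventually_forall_lt_norm {X Y E : Type*} [TopologicalSpace X]
    [TopologicalSpace Y] [NormedAddCommGroup E] {K : Set Y} (hK : IsCompact K) {x₀ : X}
    {G : X × Y → E} (hG : ∀ y ∈ K, ContinuousAt G (x₀, y)) (hne : ∀ y ∈ K, G (x₀, y) ≠ 0) :
    ∃ m > 0, ∀ᶠ x in 𝓝 x₀, ∀ y ∈ K, m < ‖G (x, y)‖ := by
  have hcont : ContinuousOn (fun y => ‖G (x₀, y)‖) K := fun y hy =>
    ((hG y hy).comp (f := fun y => (x₀, y)) (by fun_prop)).norm.continuousWithinAt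
  obtain ⟨M, hM, hle⟩ := hK.exists_forall_le' hcont fun y hy => norm_pos_iff.2 (hne y hy)
  obtain ⟨m, hm, hmM⟩ := exists_between hM
  refine ⟨m, hm, hK.eventually_forall_of_forall_eventually fun y hy => ?_⟩
  exact (hG y hy).norm.eventually (lt_mem_nhds (hmM.trans_le (hle y hy)))

-- If `0` were an isolated zero, `G (0, ·)` would be bounded below by some `m` on a small circle,
-- hence also `G (x, ·)` for small `x`; for `x ≠ 0` it has no zeros inside, so the minimum modulus
-- principle gives `m ≤ |G (x, 0)|`, and `x → 0` contradicts `G 0 = 0`.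
theorem frequently_eq_zero_of_analyticAt {G : ℂ × ℂ → ℂ} (hG : AnalyticAt ℂ G 0) (h0 : G 0 = 0) :
    ∃ᶠ p in 𝓝[≠] 0, G p = 0 := by
  intro hiso
  obtain ⟨r, hr, hball⟩ := Metric.nhds_basis_closedBall.eventually_iff.1
    ((eventually_nhdsWithin_iff.1 hiso).and hG.eventually_analyticAt)
  have hmem {x y : ℂ} (hx : x ∈ Metric.closedBall 0 r) (hy : y ∈ Metric.closedBall 0 r) :
      (x, y) ∈ Metric.closedBall (0 : ℂ × ℂ) r := by
    rw [← Prod.mk_zero_zero, ← closedBall_prod_same]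
    exact ⟨hx, hy⟩
  have hne {x y : ℂ} (hx : x ∈ Metric.closedBall 0 r) (hy : y ∈ Metric.closedBall 0 r)
      (hxy : (x, y) ≠ 0) : G (x, y) ≠ 0 := (hball (hmem hx hy)).1 hxy
  have hdiff {x y : ℂ} (hx : x ∈ Metric.closedBall 0 r) (hy : y ∈ Metric.closedBall 0 r) :
      DifferentiableAt ℂ G (x, y) := (hball (hmem hx hy)).2.differentiableAt
  have hr0 : (0 : ℂ) ∈ Metric.closedBall 0 r := Metric.mem_closedBall_self hr.le
  obtain ⟨m, hm, hcircle⟩ := exists_pos_eventually_forall_lt_norm (isCompact_sphere (0 : ℂ) r)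
    (fun y hy => (hdiff hr0 (Metric.sphere_subset_closedBall hy)).continuousAt) fun y hy =>
      hne hr0 (Metric.sphere_subset_closedBall hy) fun hy0 =>
        Metric.ne_of_mem_sphere hy hr.ne' (Prod.mk_eq_zero.1 hy0).2
  have hsmall : ∀ᶠ x in 𝓝 (0 : ℂ), ‖G (x, 0)‖ < m := by
    have hcont : ContinuousAt (fun x => ‖G (x, 0)‖) 0 :=
      ((hdiff hr0 hr0).continuousAt.comp (f := fun x => (x, (0 : ℂ))) (by fun_prop)).norm
    have hGm : ‖G (0, 0)‖ < m := by rwa [Prod.mk_zero_zero, h0, norm_zero]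
    exact hcont.eventually (gt_mem_nhds hGm)
  have hnear := (hcircle.and (hsmall.and (Metric.closedBall_mem_nhds 0 hr))).filter_mono
    (nhdsWithin_le_nhds (s := {0}ᶜ))
  obtain ⟨x, ⟨hxcircle, hxm, hxr⟩, hx0⟩ := (hnear.and eventually_mem_nhdsWithin).exists
  refine hxm.not_ge (le_norm_of_forall_mem_sphere_le_norm (g := fun y => G (x, y)) hm
    (fun y hy => ?_) (fun y hy => hne hxr hy fun h => hx0 (Prod.mk_eq_zero.1 h).1)
    (fun y hy => (hxcircle y hy).le) (Metric.mem_ball_self hr))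
  exact ((hdiff hxr hy).comp y (f := fun y => (x, y)) (by fun_prop)).differentiableWithinAt

section Taylor

variable {n : ℕ} {f : (Fin n → ℂ) → ℂ}

theorem iteratedFDeriv_comp_equiv {E F : Type*} [NormedAddCommGroup E] [NormedSpace ℂ E]
    [NormedAddCommGroup F] [NormedSpace ℂ F] [CompleteSpace F] {f : E → F} {x : E}
    (hf : AnalyticAt ℂ f x) {m m' : ℕ} (σ : Fin m ≃ Fin m') (v : Fin m' → E) :
    iteratedFDeriv ℂ m f x (v ∘ σ) = iteratedFDeriv ℂ m' f x v := by
  obtain rfl : m = m' := by simpa using Fintype.card_congr σ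
  exact hf.contDiffAt.iteratedFDeriv_comp_perm v σ

theorem iteratedFDeriv_fderiv_apply {E F : Type*} [NormedAddCommGroup E] [NormedSpace ℂ E]
    [NormedAddCommGroup F] [NormedSpace ℂ F] [CompleteSpace F] {f : E → F} {x : E}
    (hf : AnalyticAt ℂ f x) (v : E) {m : ℕ} (w : Fin m → E) :
    iteratedFDeriv ℂ m (fun z => fderiv ℂ f z v) x w =
      iteratedFDeriv ℂ (m + 1) f x (Fin.snoc w v) := by
  have hcomp := (ContinuousLinearMap.apply ℂ F v).iteratedFDeriv_comp_left
    (hf.fderiv.contDiffAt (n := ⊤)) (i := m) le_top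
  rw [iteratedFDeriv_succ_apply_right, Fin.init_snoc, Fin.snoc_last]
  exact congrArg (fun φ => φ w) hcomp

theorem analyticAt_fderiv_apply {E F : Type*} [NormedAddCommGroup E] [NormedSpace ℂ E]
    [NormedAddCommGroup F] [NormedSpace ℂ F] [CompleteSpace F] {f : E → F} {x : E}
    (hf : AnalyticAt ℂ f x) (v : E) : AnalyticAt ℂ (fun z => fderiv ℂ f z v) x :=
  ((ContinuousLinearMap.apply ℂ F v).analyticAt _).comp hf.fderiv

/-- The exponent of the monomial `∏ₖ z_{r k}`. -/
def indexCount {m : ℕ} (r : Fin m → Fin n) : Fin n → ℕ := fun i =>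
  Fintype.card {k // r k = i}

theorem indexCount_snoc {m : ℕ} (r : Fin m → Fin n) (j : Fin n) :
    indexCount (Fin.snoc r j : Fin (m + 1) → Fin n) = indexCount r + Pi.single j 1 := by
  ext i
  simp only [indexCount, Fintype.card_subtype, Finset.card_filter, Fin.sum_univ_castSucc,
    Fin.snoc_castSucc, Fin.snoc_last, Pi.add_apply, Pi.single_apply, eq_comm]

theorem indexCount_eq_zero {m : ℕ} {r : Fin m → Fin n} {i : Fin n} (h : ∀ k, r k ≠ i) :
    indexCount r i = 0 :=
  Fintype.card_eq_zero_iff.2 ⟨fun k => h k.1 k.2⟩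

theorem iteratedFDeriv_single_eq_zero (hf : AnalyticAt ℂ f 0) {m : ℕ} {r : Fin m → Fin n}
    (h : taylorCoeff f (indexCount r) = 0) :
    iteratedFDeriv ℂ m f 0 (fun k => Pi.single (r k) 1) = 0 := by
  let e : Fin m ≃ Σ i, Fin (indexCount r i) :=
    (Equiv.sigmaFiberEquiv r).symm.trans
      (Equiv.sigmaCongrRight fun i => Fintype.equivFinOfCardEq rfl)
  have he (k : Fin m) : (e k).1 = r k := rfl
  have hperm := iteratedFDeriv_comp_equiv hf (e.trans finSigmaFinEquiv)
    fun k => Pi.single (finSigmaFinEquiv.symm k).1 1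
  have hfac : (∏ i, ((indexCount r i).factorial : ℂ)) ≠ 0 :=
    Finset.prod_ne_zero_iff.2 fun i _ => Nat.cast_ne_zero.2 (Nat.factorial_ne_zero _)
  rw [taylorCoeff, mul_eq_zero, or_iff_right (inv_ne_zero hfac), ← hperm] at h
  convert h using 2
  funext k
  simp only [Function.comp_apply, Equiv.trans_apply, Equiv.symm_apply_apply, he]

theorem eventually_eq_zero_of_iteratedFDeriv_single {I : Set (Fin n)} (hf : AnalyticAt ℂ f 0)
    (h : ∀ (m : ℕ) (r : Fin m → Fin n), (∀ k, r k ∈ I) →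
      iteratedFDeriv ℂ m f 0 (fun k => Pi.single (r k) 1) = 0) :
    ∀ᶠ z in 𝓝 (0 : Fin n → ℂ), (∀ i ∉ I, z i = 0) → f z = 0 := by
  obtain ⟨p, ρ, hp⟩ := hf
  filter_upwards [Metric.eball_mem_nhds 0 hp.r_pos] with z hz hzI
  have hzero (m : ℕ) : iteratedFDeriv ℂ m f 0 (fun _ => z) = 0 := by
    have hsum : z = ∑ i, z i • (Pi.single i 1 : Fin n → ℂ) := pi_eq_sum_univ' z
    rw [hsum, ContinuousMultilinearMap.map_sum]
    refine Finset.sum_eq_zero fun r _ => ?_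
    rw [ContinuousMultilinearMap.map_smul_univ _ (fun k => z (r k)) fun k => Pi.single (r k) 1]
    by_cases hr : ∀ k, r k ∈ I
    · rw [h m r hr, smul_zero]
    · obtain ⟨k, hk⟩ := not_forall.1 hr
      rw [Finset.prod_eq_zero (Finset.mem_univ k) (hzI _ hk), zero_smul]
  have hseries := hp.hasSum_iteratedFDeriv hz
  simp only [hzero, smul_zero, zero_add] at hseries
  exact hseries.unique hasSum_zero

theorem eventually_grad_apply_eq_zero {I : Set (Fin n)} {j : Fin n} (hf : AnalyticAt ℂ f 0)
    (h : ∀ ν : Fin n → ℕ, (∀ i ∉ I, ν i = 0) → taylorCoeff f (ν + Pi.single j 1) = 0) :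
    ∀ᶠ z in 𝓝 (0 : Fin n → ℂ), (∀ i ∉ I, z i = 0) → grad f z j = 0 := by
  refine eventually_eq_zero_of_iteratedFDeriv_single (analyticAt_fderiv_apply hf _) fun m r hr => ?_
  have hcoeff := h (indexCount r) fun i hi => indexCount_eq_zero fun k hk => hi (hk ▸ hr k)
  rw [← indexCount_snoc] at hcoeff
  refine (iteratedFDeriv_fderiv_apply hf _ _).trans ?_
  rw [← iteratedFDeriv_single_eq_zero hf hcoeff]
  congr 1
  exact (Fin.comp_snoc (fun i => (Pi.single i 1 : Fin n → ℂ)) r j).symm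

theorem two_le_sum_of_taylorCoeff_ne_zero (h0 : f 0 = 0) (hgrad : grad f 0 = 0) {ν : Fin n → ℕ}
    (hν : taylorCoeff f ν ≠ 0) : 2 ≤ ∑ i, ν i := by
  have hlow (m : ℕ) (r : Fin m → Fin n) (hm : m < 2) :
      iteratedFDeriv ℂ m f 0 (fun k => Pi.single (r k) 1) = 0 := by
    interval_cases m
    · rw [iteratedFDeriv_zero_apply, h0]
    · rw [iteratedFDeriv_one_apply]
      exact congrFun hgrad (r 0)
  by_contra! hsum
  exact hν (by rw [taylorCoeff, hlow _ _ hsum, mul_zero])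

end Taylor

namespace IsIsolatedSingularity

variable {n : ℕ} {f : (Fin n → ℂ) → ℂ}

theorem eventually_grad_ne_zero (hf : IsIsolatedSingularity f) {E : Type*} [NormedAddCommGroup E]
    [NormedSpace ℂ E] (ι : E →L[ℂ] Fin n → ℂ) (hι : Function.Injective ι) :
    ∀ᶠ p in 𝓝[≠] 0, grad f (ι p) ≠ 0 := by
  have htendsto := (ι.continuous.continuousWithinAt (s := {0}ᶜ) (x := 0)).tendsto_nhdsWithin
    (t := {0}ᶜ) fun p hp h => hp (hι (h.trans ι.map_zero.symm))
  rw [ι.map_zero] at htendsto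
  exact htendsto.eventually hf.isolated

theorem exists_mem_taylorSupport_le (hf : IsIsolatedSingularity f) (i : Fin n) :
    ∃ ν ∈ taylorSupport f, ∃ j m, ν ≤ Pi.single i m + Pi.single j 1 := by
  by_contra! h
  have hgrad (j : Fin n) := eventually_grad_apply_eq_zero (I := {i}) (j := j) hf.analyticAt
    fun ν hν => by
      by_contra hne
      refine h _ hne j (ν i) (add_le_add_left (fun l => ?_) _)
      rcases eq_or_ne l i with rfl | hl
      · simp
      · simp [hν l hl]
  set ι := ContinuousLinearMap.single ℂ (fun _ : Fin n => ℂ) i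
  have hι : Filter.Tendsto ι (𝓝[≠] 0) (𝓝 0) :=
    (ι.map_zero ▸ ι.continuous.tendsto 0).mono_left nhdsWithin_le_nhds
  have hι_inj : Function.Injective ι := Pi.single_injective (M := fun _ => ℂ) i
  obtain ⟨t, hne, hzero⟩ := ((hf.eventually_grad_ne_zero ι hι_inj).and
    (hι.eventually (Filter.eventually_all.2 hgrad))).exists
  exact hne (funext fun j => hzero j fun l hl => Pi.single_eq_of_ne (M := fun _ => ℂ) hl t)

theorem exists_mem_taylorSupport_apply_eq_zero (hf : IsIsolatedSingularity f) {i j l : Fin n}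
    (hij : i ≠ j) (hil : i ≠ l) (hjl : j ≠ l) : ∃ ν ∈ taylorSupport f, ν j = 0 := by
  by_contra! h
  have hgrad (m : Fin n) (hmj : m ≠ j) := eventually_grad_apply_eq_zero (I := {i, l}) (j := m)
    hf.analyticAt fun ν hν => by
      by_contra hne
      exact h _ hne (by simp [hν j (by simp [hij.symm, hjl]), hmj.symm])
  set ι := (ContinuousLinearMap.single ℂ (fun _ : Fin n => ℂ) i).coprod
    (ContinuousLinearMap.single ℂ (fun _ : Fin n => ℂ) l)
  have hι_apply (p : ℂ × ℂ) : ι p = Pi.single i p.1 + Pi.single l p.2 := rfl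
  have hι_inj : Function.Injective ι := by
    intro p q hpq
    rw [hι_apply, hι_apply] at hpq
    exact Prod.ext (by simpa [hil] using congrFun hpq i) (by simpa [hil.symm] using congrFun hpq l)
  have hι : Filter.Tendsto ι (𝓝[≠] 0) (𝓝 0) :=
    (ι.map_zero ▸ ι.continuous.tendsto 0).mono_left nhdsWithin_le_nhds
  have hG : AnalyticAt ℂ (fun p => grad f (ι p) j) 0 := by
    refine AnalyticAt.fun_comp (g := fun z => grad f z j) ?_ (ι.analyticAt 0)
    rw [ι.map_zero]
    exact analyticAt_fderiv_apply hf.analyticAt _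
  have hG0 : grad f (ι 0) j = 0 := by rw [ι.map_zero, hf.grad_zero, Pi.zero_apply]
  obtain ⟨p, hpj, hne, hzero⟩ := ((frequently_eq_zero_of_analyticAt hG hG0).and_eventually
    ((hf.eventually_grad_ne_zero ι hι_inj).and (hι.eventually
      (Filter.eventually_all.2 fun m => Filter.eventually_imp_distrib_left.2 (hgrad m))))).exists
  refine hne (funext fun m => ?_)
  rcases eq_or_ne m j with rfl | hmj
  · exact hpj
  · refine hzero m hmj fun s hs => ?_
    rw [Set.mem_insert_iff, Set.mem_singleton_iff, not_or] at hs
    simp [hι_apply, hs.1, hs.2]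

theorem isAdmissibleSupport {f : (Fin 3 → ℂ) → ℂ} (hf : IsIsolatedSingularity f) :
    IsAdmissibleSupport (taylorSupport f) where
  two_le_sum _ hν := two_le_sum_of_taylorCoeff_ne_zero hf.map_zero hf.grad_zero hν
  near_axis := hf.exists_mem_taylorSupport_le
  meets_hyperplane j := by
    obtain ⟨i, hij⟩ := exists_ne j
    obtain ⟨l, hil, hjl⟩ := exists_fin_three_ne_ne hij
    exact hf.exists_mem_taylorSupport_apply_eq_zero hij hil hjl

end IsIsolatedSingularity

theorem theorem4_general (f : (Fin 3 → ℂ) → ℂ) (hf : IsAdmissibleSupport (taylorSupport f)) :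
    (compactFaces f 2 = ∅ ∨
        (compactFaces f 2 = exceptionalFaces f ∧ exceptionalFaces f ≠ ∅)) ↔
      (compactFaces f 1 ∩ specialSegments).Nonempty := by
  rw [← compactFaces_two_subset_iff hf]
  have hsup : exceptionalFaces f ⊆ compactFaces f 2 := fun _ ⟨_, hS⟩ => hS.1
  constructor
  · rintro (hempty | ⟨heq, -⟩)
    · exact hempty ▸ Set.empty_subset _
    · exact heq.subset
  · intro hsub
    have heq := hsub.antisymm hsup
    rcases (compactFaces f 2).eq_empty_or_nonempty with hempty | hne
    · exact Or.inl hempty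
    · exact Or.inr ⟨heq, heq ▸ hne.ne_empty⟩

theorem theorem4 (f : (Fin 3 → ℂ) → ℂ) (hf : IsIsolatedSingularity f) :
    (compactFaces f 2 = ∅ ∨
        (compactFaces f 2 = exceptionalFaces f ∧ exceptionalFaces f ≠ ∅)) ↔
      (compactFaces f 1 ∩ specialSegments).Nonempty :=
  theorem4_general f hf.isAdmissibleSupport
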